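/- All Hilbert spaces are finite-dimensional, $\log=\log_2$, and "state" means normalized density operator. For states, $P(\beta,\gamma)=\sqrt{1-\|\sqrt\beta\sqrt\gamma\|_1^2}$ is the purified distance and $B_\varepsilon(\gamma)$ is the set of states $\beta$ with $P(\beta,\gamma)\le\varepsilon$. *Catalytic decoupling.* For a state $\rho_{AE}$, let $R_c^\varepsilon(E;A)_\rho$ be the logarithm of the least dimension $|A_2|$ for which there are an ancilla system $A'$ with a state $\sigma_{A'}$, a unitary $V:AA'\to A_1A_2$ and states $\omega_{A_1},\omega_E$ with $$P\big(\mathrm{Tr}_{A_2}[V(\rho_{AE}\otimes\sigma_{A'})V^\dagger],\ \omega_{A_1}\otimes\omega_E\big)\le\varepsilon .$$ (Here the second argument $A$ is the system that is decoupled from $E$ by discarding $A_2$.) *Quantum state redistribution.* A redistribution protocol for a pure state $\psi_{ABCR}$ with error $\delta$ and quantum communication cost $q$ consists of a pure resource state $\phi_{A'B'}$ shared by Alice and Bob, an encoding channel $ACA'\to AA''C_2$ applied by Alice, where $C_2$ is sent to Bob and $\log|C_2|=q$, and a decoding channel $BB'C_2\to BCB''$ applied by Bob, such that the final state is within purified distance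 $\delta$ of $\psi_{ABCR}\otimes\phi'_{A''B''}$ for some pure state $\phi'_{A''B''}$. For trivial $A$ the task is called state merging. **Theorem.** Let $\psi_{ABCR}$ be a pure state and $\varepsilon\ge0$. There is a redistribution protocol for $\psi$ with error $3\varepsilon$ and quantum communication cost $$q^\varepsilon(R;C|A)_\psi=\inf R_c^\varepsilon(AR;CA'')_{U\rho U^\dagger},$$ where the infimum is over ancilla systems $A''$, states $\sigma_{A''}$, states $\rho_{ARCA''}\in B_\varepsilon(\psi_{RAC}\otimes\sigma_{A''})$ and unitaries $U$ on $ACA''$ such that $\mathrm{Tr}_{CA''}[U\rho U^\dagger]\in B_\varepsilon(\psi_{RA})$. For state merging (that is, $|A|=1$) the cost may be replaced by $R_c^\varepsilon(R;C)_\psi$: there is a protocol with error $3\varepsilon$ and quantum communication cost $R_c^\varepsilon(R;C)_\psi$; the infimum above restricted to $\rho=\psi_{RAC}\otimes\sigma_{A''}$ equals $R_c^\varepsilon(R;C)_\psi$, so that the ancilla $A''$ and the unitary $U$ become unnecessary; and $$R_c^{2\varepsilon}(R;C)_\psi\le q^\varepsilon(R;C|A)_\psi\le R_c^\varepsilon(R;C)_\psi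 .$$ -/

import Mathlib

open scoped ComplexOrder MatrixOrder Kronecker

noncomputable section

namespace QI

/-! A finite-dimensional Hilbert space with a chosen orthonormal basis is given by the finite type
of basis labels; operators are complex matrices, tensor products are products of label types. -/

/-- Normalized quantum states (density matrices). -/
def IsState {a : Type*} [Fintype a] (ρ : Matrix a a ℂ) : Prop :=
  ρ.PosSemidef ∧ ρ.trace = 1

/-- Unit vectors. -/
def IsKet {a : Type*} [Fintype a] (v : a → ℂ) : Prop :=
  ∑ i, ‖v i‖ ^ 2 = 1

/-- The pure state `|v⟩⟨v|`. -/
def ketbra {a : Type*} (v : a → ℂ) : Matrix a a ℂ :=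
  Matrix.vecMulVec v (star v)

/-- The trace norm `‖M‖₁ = Tr √(M† M)`. -/
def traceNorm {a : Type*} [Fintype a] [DecidableEq a] (M : Matrix a a ℂ) : ℝ :=
  (CFC.sqrt (M.conjTranspose * M)).trace.re

/-- The fidelity `‖√ρ √σ‖₁`. -/
def fidelity {a : Type*} [Fintype a] [DecidableEq a] (ρ σ : Matrix a a ℂ) : ℝ :=
  traceNorm (CFC.sqrt ρ * CFC.sqrt σ)

/-- The purified distance of two (normalized) states. -/
def purifiedDist {a : Type*} [Fintype a] [DecidableEq a] (ρ σ : Matrix a a ℂ) : ℝ :=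
  Real.sqrt (1 - fidelity ρ σ ^ 2)

/-- `ρ ∈ B_ε(σ)`: `ρ` is a state within purified distance `ε` of the state `σ`. -/
def InBall {a : Type*} [Fintype a] [DecidableEq a] (ε : ℝ) (σ ρ : Matrix a a ℂ) : Prop :=
  IsState ρ ∧ purifiedDist ρ σ ≤ ε

/-- The partial trace over the first tensor factor. -/
def trFst {a b : Type*} [Fintype a] (ρ : Matrix (a × b) (a × b) ℂ) : Matrix b b ℂ :=
  fun i j => ∑ k, ρ (k, i) (k, j)

/-- The partial trace over the second tensor factor. -/
def trSnd {a b : Type*} [Fintype b] (ρ : Matrix (a × b) (a × b) ℂ) : Matrix a a ℂ :=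
  fun i j => ∑ k, ρ (i, k) (j, k)

/-- The action `ρ ↦ (V ⊗ 1) ρ (V ⊗ 1)†` of an operator `V` on the first tensor factor. -/
def conjFst {a a' e : Type*} [Fintype a] [Fintype e] [DecidableEq e]
    (V : Matrix a' a ℂ) (ρ : Matrix (a × e) (a × e) ℂ) : Matrix (a' × e) (a' × e) ℂ :=
  (V ⊗ₖ (1 : Matrix e e ℂ)) * ρ * (V ⊗ₖ (1 : Matrix e e ℂ)).conjTranspose

/-! ### Catalytic decoupling -/

/-- For `ρ` on `A ⊗ E`: catalytic `ε`-decoupling of `A` from `E` is possible with a remainder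
system of dimension `d`. There are an ancilla `A'` (dimension `n`) in a state `σ`, and a unitary
identification `V : A A' ≅ A₁ A₂` with `|A₁| = m`, `|A₂| = d`, such that after discarding `A₂` the
state of `A₁ E` is within purified distance `ε` of some product state `ω ⊗ τ`. -/
def CatDecouples {a e : Type*} [Fintype a] [DecidableEq a] [Fintype e] [DecidableEq e]
    (ε : ℝ) (ρ : Matrix (a × e) (a × e) ℂ) (d : ℕ) : Prop :=
  ∃ (n m : ℕ) (σ : Matrix (Fin n) (Fin n) ℂ) (V : Matrix (Fin m × Fin d) (a × Fin n) ℂ)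
    (ω : Matrix (Fin m) (Fin m) ℂ) (τ : Matrix e e ℂ),
    IsState σ ∧ V.conjTranspose * V = 1 ∧ V * V.conjTranspose = 1 ∧ IsState ω ∧ IsState τ ∧
    purifiedDist
      (trSnd
        ((conjFst V
            -- the state `ρ_{AE} ⊗ σ_{A'}`, ordered as `(A A') E`
            ((ρ ⊗ₖ σ).submatrix
              (fun x : (a × Fin n) × e => ((x.1.1, x.2), x.1.2))
              (fun x : (a × Fin n) × e => ((x.1.1, x.2), x.1.2)))).submatrix
          -- reorder `(A₁ A₂) E` as `(A₁ E) A₂`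
          (fun x : (Fin m × e) × Fin d => ((x.1.1, x.2), x.1.2))
          (fun x : (Fin m × e) × Fin d => ((x.1.1, x.2), x.1.2))))
      (ω ⊗ₖ τ) ≤ ε

/-- For `ρ` on `A ⊗ E`: the minimal remainder system size for catalytically `ε`-decoupling the
first factor `A` from the second factor `E`, i.e. the binary logarithm of the minimal dimension. -/
def catRemainder {a e : Type*} [Fintype a] [DecidableEq a] [Fintype e] [DecidableEq e]
    (ε : ℝ) (ρ : Matrix (a × e) (a × e) ℂ) : ℝ :=
  Real.logb 2 (sInf {d : ℕ | CatDecouples ε ρ d} : ℕ)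

/-! ### The communication cost of redistribution

Pure states `ψ` on `A ⊗ B ⊗ C ⊗ R`. -/

section Cost

variable {a b c r : Type*} [Fintype a] [DecidableEq a] [Fintype b] [DecidableEq b]
  [Fintype c] [DecidableEq c] [Fintype r] [DecidableEq r]

/-- The marginal `ψ_{ACR}`, ordered as `(A C) R`. -/
def margACR (ψ : a × b × c × r → ℂ) : Matrix ((a × c) × r) ((a × c) × r) ℂ :=
  trFst ((ketbra ψ).submatrix
    (fun x : b × (a × c) × r => (x.2.1.1, x.1, x.2.1.2, x.2.2))
    (fun x : b × (a × c) × r => (x.2.1.1, x.1, x.2.1.2, x.2.2)))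

/-- The marginal `ψ_{AR}`. -/
def margAR (ψ : a × b × c × r → ℂ) : Matrix (a × r) (a × r) ℂ :=
  trFst ((ketbra ψ).submatrix
    (fun x : (b × c) × (a × r) => (x.2.1, x.1.1, x.1.2, x.2.2))
    (fun x : (b × c) × (a × r) => (x.2.1, x.1.1, x.1.2, x.2.2)))

/-- The marginal `ψ_{CR}`. -/
def margCR (ψ : a × b × c × r → ℂ) : Matrix (c × r) (c × r) ℂ :=
  trFst ((ketbra ψ).submatrix
    (fun x : (a × b) × (c × r) => (x.1.1, x.1.2, x.2.1, x.2.2))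
    (fun x : (a × b) × (c × r) => (x.1.1, x.1.2, x.2.1, x.2.2)))

/-- The state `ψ_{ACR} ⊗ σ_{A''}`, ordered as `(A C A'') R`. -/
def withAncilla (ψ : a × b × c × r → ℂ) {n : ℕ} (σ : Matrix (Fin n) (Fin n) ℂ) :
    Matrix ((a × c × Fin n) × r) ((a × c × Fin n) × r) ℂ :=
  (margACR ψ ⊗ₖ σ).submatrix
    (fun x : (a × c × Fin n) × r => (((x.1.1, x.1.2.1), x.2), x.1.2.2))
    (fun x : (a × c × Fin n) × r => (((x.1.1, x.1.2.1), x.2), x.1.2.2))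

/-- The state `U ρ U†` for `ρ` on `(A C A'') R` and `U` acting on `A C A''`, reordered as
`(C A'') (A R)`. -/
def rotated {n : ℕ} (U : Matrix (a × c × Fin n) (a × c × Fin n) ℂ)
    (ρ : Matrix ((a × c × Fin n) × r) ((a × c × Fin n) × r) ℂ) :
    Matrix ((c × Fin n) × (a × r)) ((c × Fin n) × (a × r)) ℂ :=
  (conjFst U ρ).submatrix
    (fun x : (c × Fin n) × (a × r) => ((x.2.1, x.1.1, x.1.2), x.2.2))
    (fun x : (c × Fin n) × (a × r) => ((x.2.1, x.1.1, x.1.2), x.2.2))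

/-- The tuples over which the cost is minimized: a state `σ` of the ancilla `A''`, a state
`ρ ∈ B_ε(ψ_{ACR} ⊗ σ)` and a unitary `U` on `A C A''` such that
`Tr_{C A''} (U ρ U†) ∈ B_ε(ψ_{AR})`. -/
def Feasible (ε : ℝ) (ψ : a × b × c × r → ℂ) {n : ℕ} (σ : Matrix (Fin n) (Fin n) ℂ)
    (ρ : Matrix ((a × c × Fin n) × r) ((a × c × Fin n) × r) ℂ)
    (U : Matrix (a × c × Fin n) (a × c × Fin n) ℂ) : Prop :=
  IsState σ ∧ InBall ε (withAncilla ψ σ) ρ ∧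
    U ∈ Matrix.unitaryGroup (a × c × Fin n) ℂ ∧
    InBall ε (margAR ψ) (trFst (rotated U ρ))

/-- The cost `q^ε(R;C|A)_ψ`: the infimum over ancillas `A''` and feasible `σ`, `ρ`, `U` of the
minimal remainder size for catalytically `ε`-decoupling `C A''` from `A R` in `U ρ U†`. -/
def qCost (ε : ℝ) (ψ : a × b × c × r → ℂ) : ℝ :=
  sInf {x : ℝ | ∃ (n : ℕ) (σ : Matrix (Fin n) (Fin n) ℂ)
    (ρ : Matrix ((a × c × Fin n) × r) ((a × c × Fin n) × r) ℂ)
    (U : Matrix (a × c × Fin n) (a × c × Fin n) ℂ),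
    Feasible ε ψ σ ρ U ∧ x = catRemainder ε (rotated U ρ)}

/-- The same infimum, restricted to `ρ = ψ_{ACR} ⊗ σ_{A''}` (no smoothing of the state). -/
def qCostExact (ε : ℝ) (ψ : a × b × c × r → ℂ) : ℝ :=
  sInf {x : ℝ | ∃ (n : ℕ) (σ : Matrix (Fin n) (Fin n) ℂ)
    (U : Matrix (a × c × Fin n) (a × c × Fin n) ℂ),
    Feasible ε ψ σ (withAncilla ψ σ) U ∧ x = catRemainder ε (rotated U (withAncilla ψ σ))}

end Cost

/-! ### Quantum state redistribution protocols -/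

/-- A quantum channel (CPTP map) from operators on `a` to operators on `b`, in Kraus form. -/
structure Channel (a b : Type*) [Fintype a] [DecidableEq a] [Fintype b] where
  rank : ℕ
  kraus : Fin rank → Matrix b a ℂ
  tracePreserving : ∑ k, (kraus k).conjTranspose * kraus k = 1

/-- The channel `Φ ⊗ id` applied to a bipartite operator. -/
def Channel.onFst {a b e : Type*} [Fintype a] [DecidableEq a] [Fintype b] [Fintype e]
    [DecidableEq e] (Φ : Channel a b) (ρ : Matrix (a × e) (a × e) ℂ) :
    Matrix (b × e) (b × e) ℂ :=
  ∑ k, conjFst (Φ.kraus k) ρ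

section Protocol

variable {a b c r : Type*} [Fintype a] [DecidableEq a] [Fintype b] [DecidableEq b]
  [Fintype c] [DecidableEq c] [Fintype r] [DecidableEq r]

/-- The output on `(A B C R) (A'' B'')` of the one-way protocol with input `ψ` and resource `φ` on
`A' B'`: Alice applies `enc : A C A' → A A'' C₂` and sends `C₂` to Bob, who applies
`dec : B B' C₂ → B C B''`. -/
def protocolOutput (ψ : a × b × c × r → ℂ) {k l k' l' d : ℕ} (φ : Fin k × Fin l → ℂ)
    (enc : Channel (a × c × Fin k) (a × Fin k' × Fin d))
    (dec : Channel (b × Fin l × Fin d) (b × c × Fin l')) :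
    Matrix ((a × b × c × r) × (Fin k' × Fin l')) ((a × b × c × r) × (Fin k' × Fin l')) ℂ :=
  -- the initial state, ordered as `(A C A') (B B' R)`
  let ρ₀ := (ketbra ψ ⊗ₖ ketbra φ).submatrix
    (fun x : (a × c × Fin k) × (b × Fin l × r) =>
      ((x.1.1, x.2.1, x.1.2.1, x.2.2.2), (x.1.2.2, x.2.2.1)))
    (fun x : (a × c × Fin k) × (b × Fin l × r) =>
      ((x.1.1, x.2.1, x.1.2.1, x.2.2.2), (x.1.2.2, x.2.2.1)))
  -- the state after the transmission of `C₂`, ordered as `(B B' C₂) (A A'' R)`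
  let ρ₁ := (enc.onFst ρ₀).submatrix
    (fun x : (b × Fin l × Fin d) × (a × Fin k' × r) =>
      ((x.2.1, x.2.2.1, x.1.2.2), (x.1.1, x.1.2.1, x.2.2.2)))
    (fun x : (b × Fin l × Fin d) × (a × Fin k' × r) =>
      ((x.2.1, x.2.2.1, x.1.2.2), (x.1.1, x.1.2.1, x.2.2.2)))
  (dec.onFst ρ₁).submatrix
    (fun x : (a × b × c × r) × (Fin k' × Fin l') =>
      ((x.1.2.1, x.1.2.2.1, x.2.2), (x.1.1, x.2.1, x.1.2.2.2)))
    (fun x : (a × b × c × r) × (Fin k' × Fin l') =>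
      ((x.1.2.1, x.1.2.2.1, x.2.2), (x.1.1, x.2.1, x.1.2.2.2)))

/-- There is a quantum state redistribution protocol for `ψ` with purified-distance error `δ` and
quantum communication cost `q`: for some pure resource state `φ` on `A' B'`, some register `C₂` with
`log₂ |C₂| = q`, and some encoding and decoding channels, the output is within purified distance
`δ` of `ψ_{ABCR} ⊗ φ'_{A''B''}` for some pure state `φ'`. -/
def QSRAchievable (ψ : a × b × c × r → ℂ) (δ q : ℝ) : Prop :=
  ∃ (k l k' l' d : ℕ) (φ : Fin k × Fin l → ℂ) (φ' : Fin k' × Fin l' → ℂ)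
    (enc : Channel (a × c × Fin k) (a × Fin k' × Fin d))
    (dec : Channel (b × Fin l × Fin d) (b × c × Fin l')),
    IsKet φ ∧ IsKet φ' ∧ Real.logb 2 d = q ∧
    purifiedDist (protocolOutput ψ φ enc dec) (ketbra ψ ⊗ₖ ketbra φ') ≤ δ

end Protocol

end QI

end

/-! Catalytic decoupling leaves `A₁` nearly in product with `AR`, and Uhlmann's theorem turns this
into a decoder. Alice applies `U` and then the decoupling unitary `V`, taking her ancilla and
catalyst from a shared purification, and sends the discarded system `A₂`. If the state left on
`A₁AR` is close to `ω ⊗ ψ_{AR}`, then Bob, who holds the purifying systems, can bring the global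
state close to `ψ` tensored with a purification of `ω`.

Everything is computed with amplitudes, that is, matrices `A` with `ρ = A Aᴴ` whose columns index
the environment. The fidelity of `A Aᴴ` and `B Bᴴ` is the maximum of `hsInner A (B * K)` over
contractions `K` (`le_fidelity`, `exists_contr_fidelity`). Contractions replace the partial
isometries of Uhlmann's theorem, so environments of different dimension cause no trouble. Since any
contraction is one Kraus operator of a channel (`exists_channel_kraus`), the optimal `K` gives Bob's
decoder.

The constant `3` comes from `purifiedDist_kronecker_le`. Going from `ψ ⊗ σ` to `ρ`, then to `ω ⊗ τ`,
and replacing `τ` by `ψ_{AR}` through the marginal of `ρ` costs `4ε` by triangle inequalities.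
Instead, the optimal contraction for `ω ⊗ τ` is reused to compare with `ω ⊗ ψ_{AR}`. It nearly
preserves the amplitude of the decoupled `ρ`, which yields fidelity at least `1 - 4ε²`, and `(1 -
4ε²)² ≥ 1 - 9ε²`.

For trivial `A`, the ancilla and `U` can be absorbed into the catalyst and `V`, so they do not help
without smoothing. Undoing the smoothing costs one more `ε`, by `purifiedDist_le_two_mul`. The
infima are attained because all their values are logarithms of natural numbers. -/

noncomputable section

namespace QI

open Matrix

set_option linter.unusedSectionVars false

/-! ### Contractions, polar decomposition and the variational formula for the fidelity. -/

section TraceNorm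

variable {p q f g : Type*} [Fintype p] [Fintype q] [Fintype f] [Fintype g]

/-- The real part of the Hilbert-Schmidt inner product. -/
def hsInner (u v : Matrix p q ℂ) : ℝ := (uᴴ * v).trace.re

lemma hsInner_add_left (u v w : Matrix p q ℂ) :
    hsInner (u + v) w = hsInner u w + hsInner v w := by
  simp [hsInner, Matrix.add_mul]

lemma hsInner_smul_left (t : ℝ) (u v : Matrix p q ℂ) :
    hsInner (t • u) v = t * hsInner u v := by
  simp [hsInner]

lemma hsInner_comm (u v : Matrix p q ℂ) : hsInner u v = hsInner v u := by
  have h : (vᴴ * u).trace = star (uᴴ * v).trace := by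
    rw [← trace_conjTranspose, conjTranspose_mul, conjTranspose_conjTranspose]
  simp [hsInner, h]

lemma hsInner_add_right (u v w : Matrix p q ℂ) :
    hsInner u (v + w) = hsInner u v + hsInner u w := by
  rw [hsInner_comm, hsInner_add_left, hsInner_comm v, hsInner_comm w]

lemma hsInner_smul_right (t : ℝ) (u v : Matrix p q ℂ) :
    hsInner u (t • v) = t * hsInner u v := by
  rw [hsInner_comm, hsInner_smul_left, hsInner_comm]

lemma hsInner_sub_left (u v w : Matrix p q ℂ) :
    hsInner (u - v) w = hsInner u w - hsInner v w := by
  simp [hsInner, Matrix.sub_mul]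

lemma hsInner_sub_right (u v w : Matrix p q ℂ) :
    hsInner u (v - w) = hsInner u v - hsInner u w := by
  simp [hsInner, Matrix.mul_sub]

lemma hsInner_self_nonneg (u : Matrix p q ℂ) : 0 ≤ hsInner u u :=
  (Complex.nonneg_iff.1 (posSemidef_conjTranspose_mul_self u).trace_nonneg).1

lemma hsInner_le (u v : Matrix p q ℂ) : hsInner u v ≤ (hsInner u u + hsInner v v) / 2 := by
  have h := hsInner_self_nonneg (u - v)
  simp only [hsInner_sub_left, hsInner_sub_right] at h
  rw [hsInner_comm v u] at h
  linarith

lemma neg_hsInner_le (u v : Matrix p q ℂ) : -hsInner u v ≤ (hsInner u u + hsInner v v) / 2 := by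
  have h := hsInner_self_nonneg (u + v)
  simp only [hsInner_add_left, hsInner_add_right] at h
  rw [hsInner_comm v u] at h
  linarith

lemma hsInner_mul_right_left (u : Matrix p q ℂ) (N : Matrix q f ℂ) (v : Matrix p f ℂ) :
    hsInner (u * N) v = hsInner u (v * Nᴴ) := by
  simp only [hsInner, conjTranspose_mul]
  rw [Matrix.mul_assoc, trace_mul_comm, Matrix.mul_assoc]

/-- Contractions `Kᴴ K ≤ 1`. -/
def IsContr [DecidableEq q] (K : Matrix p q ℂ) : Prop := (1 - Kᴴ * K).PosSemidef

/-- The identity `1 - K Kᴴ = K (1 - Kᴴ K) Kᴴ + (1 - K Kᴴ)²` exhibits the defect as a sum of positive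
terms. -/
lemma IsContr.conjTranspose [DecidableEq p] [DecidableEq q] {K : Matrix p q ℂ} (h : IsContr K) :
    IsContr Kᴴ := by
  have h1 : (K * (1 - Kᴴ * K) * Kᴴ).PosSemidef := h.mul_mul_conjTranspose_same K
  have h2 : ((1 - K * Kᴴ)ᴴ * (1 - K * Kᴴ)).PosSemidef := posSemidef_conjTranspose_mul_self _
  have h3 := h1.add h2
  unfold IsContr
  convert h3 using 1
  simp only [conjTranspose_conjTranspose, conjTranspose_sub, conjTranspose_one, conjTranspose_mul,
    Matrix.mul_sub, Matrix.sub_mul, Matrix.mul_one, Matrix.one_mul, Matrix.mul_assoc]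
  abel

lemma IsContr.mul [DecidableEq q] [DecidableEq f] {K : Matrix p q ℂ} {L : Matrix q f ℂ}
    (hK : IsContr K) (hL : IsContr L) : IsContr (K * L) := by
  have h1 : (Lᴴ * (1 - Kᴴ * K) * L).PosSemidef := hK.conjTranspose_mul_mul_same L
  have h3 := h1.add hL
  unfold IsContr
  convert h3 using 1
  simp only [conjTranspose_mul, Matrix.mul_sub, Matrix.sub_mul, Matrix.mul_one, Matrix.mul_assoc]
  abel

lemma IsContr.of_isometry [DecidableEq q] {K : Matrix p q ℂ} (h : Kᴴ * K = 1) : IsContr K := by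
  simp [IsContr, h, PosSemidef.zero]

lemma IsContr.hsInner_mul_left_le [DecidableEq p] {K : Matrix f p ℂ} (hK : IsContr K)
    (u : Matrix p q ℂ) : hsInner (K * u) (K * u) ≤ hsInner u u := by
  have h1 : (uᴴ * (1 - Kᴴ * K) * u).PosSemidef := hK.conjTranspose_mul_mul_same u
  have h2 := (Complex.nonneg_iff.1 h1.trace_nonneg).1
  simp only [hsInner, conjTranspose_mul]
  simp only [Matrix.mul_sub, Matrix.sub_mul, Matrix.mul_one, trace_sub, Complex.sub_re,
    Matrix.mul_assoc] at h2 ⊢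
  linarith

lemma hsInner_conjTranspose (u v : Matrix p q ℂ) : hsInner uᴴ vᴴ = hsInner u v := by
  rw [hsInner_comm u v]
  simp only [hsInner, conjTranspose_conjTranspose]
  rw [trace_mul_comm]

lemma IsContr.hsInner_mul_right_le [DecidableEq q] [DecidableEq f] {K : Matrix q f ℂ}
    (hK : IsContr K) (u : Matrix p q ℂ) : hsInner (u * K) (u * K) ≤ hsInner u u := by
  rw [← hsInner_conjTranspose, ← hsInner_conjTranspose u, conjTranspose_mul]
  exact hK.conjTranspose.hsInner_mul_left_le _

lemma sqrt_posSemidef [DecidableEq p] (ρ : Matrix p p ℂ) : (CFC.sqrt ρ).PosSemidef :=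
  nonneg_iff_posSemidef.1 (CFC.sqrt_nonneg ρ)

lemma sqrt_mul_self_eq [DecidableEq p] {ρ : Matrix p p ℂ} (h : ρ.PosSemidef) :
    CFC.sqrt ρ * CFC.sqrt ρ = ρ :=
  CFC.sqrt_mul_sqrt_self ρ h.nonneg

lemma sqrt_conjTranspose [DecidableEq p] (ρ : Matrix p p ℂ) : (CFC.sqrt ρ)ᴴ = CFC.sqrt ρ :=
  (sqrt_posSemidef ρ).isHermitian

lemma sqrt_mul_conjTranspose [DecidableEq p] {ρ : Matrix p p ℂ} (h : ρ.PosSemidef) :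
    CFC.sqrt ρ * (CFC.sqrt ρ)ᴴ = ρ := by
  rw [sqrt_conjTranspose, sqrt_mul_self_eq h]

lemma sqrt_eq_of_mul_self [DecidableEq p] {ρ S : Matrix p p ℂ} (h : S * S = ρ)
    (hS : S.PosSemidef) : CFC.sqrt ρ = S :=
  CFC.sqrt_unique h hS.nonneg

/-- Cauchy-Schwarz for `√P` and `C √P`, the second of which has norm at most that of `√P`. -/
lemma PosSemidef.re_trace_mul_le [DecidableEq p] {P C : Matrix p p ℂ} (hP : P.PosSemidef)
    (hC : IsContr C) : (P * C).trace.re ≤ P.trace.re := by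
  have h1 := hsInner_le (CFC.sqrt P) (C * CFC.sqrt P)
  have h2 := hC.hsInner_mul_left_le (CFC.sqrt P)
  have h3 : hsInner (CFC.sqrt P) (CFC.sqrt P) = P.trace.re := by
    rw [hsInner, sqrt_conjTranspose, sqrt_mul_self_eq hP]
  have h4 : hsInner (CFC.sqrt P) (C * CFC.sqrt P) = (P * C).trace.re := by
    rw [hsInner, sqrt_conjTranspose, ← Matrix.mul_assoc, trace_mul_comm, ← Matrix.mul_assoc,
      sqrt_mul_self_eq hP]
  linarith

/-- Polar decomposition with a contraction. -/
lemma exists_polar [DecidableEq p] [DecidableEq q] (M : Matrix p q ℂ) :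
    ∃ K : Matrix q p ℂ, IsContr K ∧ K * M = CFC.sqrt (Mᴴ * M) ∧ M = Kᴴ * CFC.sqrt (Mᴴ * M) := by
  have hP : (Mᴴ * M).PosSemidef := posSemidef_conjTranspose_mul_self M
  have hsa : IsSelfAdjoint (Mᴴ * M) := hP.isHermitian
  have hc (h : ℝ → ℝ) : ContinuousOn h (spectrum ℝ (Mᴴ * M)) :=
    (Matrix.finite_real_spectrum (A := Mᴴ * M)).continuousOn h
  have hspec : ∀ x ∈ spectrum ℝ (Mᴴ * M), 0 ≤ x :=
    fun x hx => spectrum_nonneg_of_nonneg hP.nonneg hx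
  set T := Mᴴ * M with hT
  -- The pseudo-inverse of `√T`: the convention `0⁻¹ = 0` makes it vanish on the kernel.
  set D := cfc (fun x : ℝ => (√x)⁻¹) T with hD
  have hDh : Dᴴ = D := (cfc_predicate (R := ℝ) (p := IsSelfAdjoint) _ T : IsSelfAdjoint _)
  have hid : cfc (fun x : ℝ => x) T = T := cfc_id' ℝ T
  have hsq : CFC.sqrt T = cfc (fun x : ℝ => √x) T := by
    rw [CFC.sqrt_eq_real_sqrt T hP.nonneg, cfcₙ_eq_cfc]
  have hDT : D * T = CFC.sqrt T := by
    rw [hsq]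
    nth_rewrite 1 [← hid]
    rw [hD, ← cfc_mul _ _ T (hc _) (hc _)]
    refine cfc_congr fun x hx => ?_
    rcases eq_or_ne (√x) 0 with h | h
    · simp [(Real.sqrt_eq_zero (hspec x hx)).1 h]
    · field_simp; rw [Real.sq_sqrt (hspec x hx)]
  have hDTD : 1 - D * T * D = cfc (fun x : ℝ => 1 - √x * (√x)⁻¹) T := by
    rw [cfc_sub _ _ T (hc _) (hc _), cfc_const_one ℝ T, cfc_mul _ _ T (hc _) (hc _), hDT, hsq]
  refine ⟨D * Mᴴ, ?_, ?_, ?_⟩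
  · rw [← conjTranspose_conjTranspose (D * Mᴴ)]
    apply IsContr.conjTranspose
    have : 1 - (D * Mᴴ)ᴴᴴ * (D * Mᴴ)ᴴ = 1 - D * T * D := by
      rw [conjTranspose_conjTranspose, conjTranspose_mul, conjTranspose_conjTranspose, hDh, hT]
      simp only [Matrix.mul_assoc]
    rw [IsContr, this, hDTD, ← nonneg_iff_posSemidef]
    refine cfc_nonneg fun x hx => ?_
    rcases eq_or_ne (√x) 0 with h | h
    · simp [h]
    · simp [h]
  · rw [Matrix.mul_assoc, ← hT, hDT]
  · rw [conjTranspose_mul, conjTranspose_conjTranspose, hDh, ← hDT]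
    -- `1 - D (D T)` is the projection onto the kernel of `T = Mᴴ M`, which is also the kernel of
    -- `M`.
    have h0 : T * (1 - D * (D * T)) = 0 := by
      rw [hDT, Matrix.mul_sub, Matrix.mul_one, sub_eq_zero]
      rw [hsq, hD, ← cfc_mul _ _ T (hc _) (hc _)]
      nth_rewrite 1 [← hid]
      nth_rewrite 2 [← hid]
      rw [← cfc_mul _ _ T (hc _) (hc _)]
      refine cfc_congr fun x hx => ?_
      rcases eq_or_ne (√x) 0 with h | h
      · simp [(Real.sqrt_eq_zero (hspec x hx)).1 h]
      · simp [h]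
    have h1 : M * (1 - D * (D * T)) = 0 := by
      rw [← conjTranspose_mul_self_eq_zero, conjTranspose_mul]
      rw [Matrix.mul_assoc, ← Matrix.mul_assoc Mᴴ, ← hT, h0, Matrix.mul_zero]
    rw [Matrix.mul_sub, Matrix.mul_one, sub_eq_zero] at h1
    simpa [Matrix.mul_assoc] using h1

lemma exists_contr_traceNorm [DecidableEq p] [DecidableEq q] (M : Matrix p q ℂ) :
    ∃ K : Matrix q p ℂ, IsContr K ∧ (M * K).trace.re = (CFC.sqrt (Mᴴ * M)).trace.re := by
  obtain ⟨K, hK, h, -⟩ := exists_polar M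
  exact ⟨K, hK, by rw [trace_mul_comm, h]⟩

lemma re_trace_mul_le [DecidableEq p] [DecidableEq q] (M : Matrix p q ℂ) {K : Matrix q p ℂ}
    (hK : IsContr K) : (M * K).trace.re ≤ (CFC.sqrt (Mᴴ * M)).trace.re := by
  obtain ⟨L, hL, -, h⟩ := exists_polar M
  have : (M * K).trace = (CFC.sqrt (Mᴴ * M) * (K * Lᴴ)).trace := by
    nth_rewrite 1 [h]
    rw [Matrix.mul_assoc, trace_mul_comm, Matrix.mul_assoc]
  rw [this]
  exact PosSemidef.re_trace_mul_le (sqrt_posSemidef _) (hK.mul hL.conjTranspose)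

/-- Fidelity is at least the overlap of amplitudes, up to a contraction of the environment. -/
lemma le_fidelity [DecidableEq p] [DecidableEq f] [DecidableEq g] (A : Matrix p f ℂ)
    (B : Matrix p g ℂ) {K : Matrix g f ℂ} (hK : IsContr K) :
    hsInner A (B * K) ≤ fidelity (A * Aᴴ) (B * Bᴴ) := by
  obtain ⟨KA, hKA, -, hA⟩ := exists_polar Aᴴ
  obtain ⟨KB, hKB, -, hB⟩ := exists_polar Bᴴ
  rw [conjTranspose_conjTranspose] at hA hB
  have hB' : B = CFC.sqrt (B * Bᴴ) * KB := by
    simpa [conjTranspose_mul, sqrt_conjTranspose] using congrArg Matrix.conjTranspose hB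
  unfold fidelity traceNorm
  refine le_trans (le_of_eq ?_) (re_trace_mul_le (CFC.sqrt (A * Aᴴ) * CFC.sqrt (B * Bᴴ))
    ((hKB.mul hK).mul hKA.conjTranspose))
  rw [hsInner]
  nth_rewrite 1 [hA]
  nth_rewrite 1 [hB']
  simp only [Matrix.mul_assoc]
  rw [trace_mul_comm]
  simp only [Matrix.mul_assoc]

/-- The optimal contraction for `‖√ρ √σ‖₁` is carried from the square roots to arbitrary amplitudes
by the polar factors. -/
lemma exists_contr_fidelity [DecidableEq p] [DecidableEq f] [DecidableEq g] (A : Matrix p f ℂ)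
    (B : Matrix p g ℂ) : ∃ K : Matrix g f ℂ, IsContr K ∧
      hsInner A (B * K) = fidelity (A * Aᴴ) (B * Bᴴ) := by
  obtain ⟨KA, hKA, hA, -⟩ := exists_polar Aᴴ
  obtain ⟨KB, hKB, hB, -⟩ := exists_polar Bᴴ
  rw [conjTranspose_conjTranspose] at hA hB
  obtain ⟨K, hK, h⟩ := exists_contr_traceNorm (CFC.sqrt (A * Aᴴ) * CFC.sqrt (B * Bᴴ))
  have hB' : B * KBᴴ = CFC.sqrt (B * Bᴴ) := by
    rw [← sqrt_conjTranspose, ← hB, conjTranspose_mul, conjTranspose_conjTranspose]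
  have hS : hsInner A (B * (KBᴴ * K * KA)) = fidelity (A * Aᴴ) (B * Bᴴ) := by
    unfold fidelity traceNorm
    rw [← h, ← hB', hsInner, ← hA]
    simp only [Matrix.mul_assoc]
    rw [trace_mul_comm KA]
    simp only [Matrix.mul_assoc]
  exact ⟨_, (hKB.conjTranspose.mul hK).mul hKA, hS⟩

end TraceNorm

/-! ### Overlap estimates in Hilbert-Schmidt space, and moving a factor to the environment. -/

section KeyInequality

variable {p q f e m : Type*} [Fintype p] [Fintype q] [Fintype f] [Fintype e] [Fintype m]

lemma one_sub_le_mul {α β t : ℝ} (hα : 0 ≤ α) (hβ : 0 ≤ β) (hα2 : 1 - t ≤ α ^ 2)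
    (hβ2 : 1 - t ≤ β ^ 2) : 1 - t ≤ α * β := by
  rcases le_total α β with h | h
  · nlinarith
  · nlinarith

/-- Two vectors with a large overlap with `x` have a large overlap with each other. -/
lemma le_hsInner_of_le {x x₀ z : Matrix p q ℂ} {t : ℝ} (hx : hsInner x x = 1)
    (hx₀ : hsInner x₀ x₀ ≤ 1) (hz : hsInner z z ≤ 1) (h₀ : 0 ≤ hsInner x₀ x)
    (h₀t : 1 - t ≤ hsInner x₀ x ^ 2) (h₁ : 0 ≤ hsInner x z) (h₁t : 1 - t ≤ hsInner x z ^ 2) :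
    1 - 2 * t ≤ hsInner x₀ z := by
  set α := hsInner x₀ x
  set β := hsInner x z
  have hzx : hsInner z x = β := hsInner_comm _ _
  have hxx : hsInner x x₀ = α := hsInner_comm _ _
  -- The components orthogonal to `x` have squared norm at most `t` each, so their overlap lowers `α
  -- * β ≥ 1 - t` by at most `t`.
  have h := neg_hsInner_le (x₀ - α • x) (z - β • x)
  simp only [hsInner_sub_left, hsInner_sub_right, hsInner_smul_left, hsInner_smul_right, hzx, hxx,
    hx] at h
  have hαβ := one_sub_le_mul h₀ h₁ h₀t h₁t
  rw [show hsInner x z = β from rfl, show hsInner x₀ x = α from rfl] at h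
  nlinarith

/-- As `le_hsInner_of_le`, after applying a contraction that nearly preserves the norm of `x`. -/
lemma le_hsInner_mul_of_le [DecidableEq q] [DecidableEq f] {x x₀ z : Matrix p q ℂ}
    {N : Matrix q f ℂ} (hN : IsContr N) {t : ℝ} (ht : t ≤ 1) (hx : hsInner x x = 1)
    (hx₀ : hsInner x₀ x₀ ≤ 1) (hz : hsInner z z ≤ 1) (h₀ : 0 ≤ hsInner x₀ x)
    (h₀t : 1 - t ≤ hsInner x₀ x ^ 2) (h₁ : 0 ≤ hsInner x z) (h₁t : 1 - t ≤ hsInner x z ^ 2)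
    (hNx : 1 - t ≤ hsInner (x * N) (x * N)) :
    1 - 4 * t ≤ hsInner (x₀ * N) (z * N) := by
  set α := hsInner x₀ x with hα
  set β := hsInner x z with hβ
  have hzx : hsInner z x = β := hsInner_comm _ _
  have hxx : hsInner x x₀ = α := hsInner_comm _ _
  obtain ⟨a, ha⟩ : ∃ a, x₀ = α • x + a := ⟨x₀ - α • x, by abel⟩
  obtain ⟨b, hb⟩ : ∃ b, z = β • x + b := ⟨z - β • x, by abel⟩
  have hax : hsInner x a = 0 := by
    rw [ha, hsInner_add_right, hsInner_smul_right, hx] at hxx; linarith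
  have hbx : hsInner x b = 0 := by
    have : β = hsInner x z := rfl
    rw [hb, hsInner_add_right, hsInner_smul_right, hx] at this; linarith
  have hax' : hsInner a x = 0 := by rw [hsInner_comm, hax]
  have hbx' : hsInner b x = 0 := by rw [hsInner_comm, hbx]
  have haa : hsInner a a ≤ 1 - α ^ 2 := by
    rw [ha] at hx₀
    simp only [hsInner_add_left, hsInner_add_right, hsInner_smul_left, hsInner_smul_right, hx,
      hax, hax'] at hx₀
    linarith
  have hbb : hsInner b b ≤ 1 - β ^ 2 := by
    rw [hb] at hz
    simp only [hsInner_add_left, hsInner_add_right, hsInner_smul_left, hsInner_smul_right, hx,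
      hbx, hbx'] at hz
    linarith
  have hα1 : α ≤ 1 := by nlinarith [hsInner_self_nonneg a]
  have hβ1 : β ≤ 1 := by nlinarith [hsInner_self_nonneg b]
  have hαβ := one_sub_le_mul h₀ h₁ h₀t h₁t
  have hab := neg_hsInner_le (a * N) (b * N)
  -- Expanding `‖(x - c) N‖² ≤ ‖x - c‖²` bounds the cross term by the norm lost by `x` and by `c`;
  -- the term in `c * N` is kept for a later cancellation.
  have key : ∀ c, hsInner x c = 0 → hsInner (x * N) (c * N) ≥
      -(t + (hsInner c c - hsInner (c * N) (c * N))) / 2 := by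
    intro c hc
    have hc' : hsInner c x = 0 := by rw [hsInner_comm, hc]
    have h := hN.hsInner_mul_right_le (x - c)
    simp only [Matrix.sub_mul, hsInner_sub_left, hsInner_sub_right, hx, hc, hc',
      hsInner_comm (c * N) (x * N)] at h
    linarith
  have ka := key a hax
  have kb := key b hbx
  have hac := hN.hsInner_mul_right_le a
  have hbc := hN.hsInner_mul_right_le b
  have ht0 : 0 ≤ t := by nlinarith [hsInner_self_nonneg a]
  have hexp : hsInner (x₀ * N) (z * N) = α * β * hsInner (x * N) (x * N)
      + α * hsInner (x * N) (b * N) + β * hsInner (x * N) (a * N) + hsInner (a * N) (b * N) := by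
    rw [ha, hb]
    simp only [Matrix.add_mul, Matrix.smul_mul, hsInner_add_left, hsInner_add_right,
      hsInner_smul_left, hsInner_smul_right, hsInner_comm (a * N) (x * N)]
    ring
  have k1 : α * hsInner (x * N) (b * N) ≥
      -(t + (hsInner b b - hsInner (b * N) (b * N))) / 2 := by nlinarith
  have k2 : β * hsInner (x * N) (a * N) ≥
      -(t + (hsInner a a - hsInner (a * N) (a * N))) / 2 := by nlinarith
  have k3 : α * β * hsInner (x * N) (x * N) ≥ (1 - t) * (1 - t) :=
    mul_le_mul hαβ hNx (by linarith) (by positivity)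
  -- The norms of `a * N` and `b * N` cancel between the cross terms and `hab`. What remains is `(1
  -- - t)² - t - (‖a‖² + ‖b‖²) / 2 ≥ 1 - 4t`.
  rw [hexp]
  nlinarith

/-- Cauchy-Schwarz for a unit vector. -/
lemma hsInner_sq_le {u v : Matrix p q ℂ} (hu : hsInner u u = 1) :
    hsInner u v ^ 2 ≤ hsInner v v := by
  have h := hsInner_self_nonneg (v - hsInner u v • u)
  simp only [hsInner_sub_left, hsInner_sub_right, hsInner_smul_left, hsInner_smul_right, hu,
    hsInner_comm v u] at h
  nlinarith

/-- The amplitude matrix with the first tensor factor moved to the environment. -/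
def envFst (A : Matrix (m × e) f ℂ) : Matrix e (m × f) ℂ := fun j x => A (x.1, j) x.2

lemma envFst_mul_conjTranspose (A B : Matrix (m × e) f ℂ) :
    envFst A * (envFst B)ᴴ = trFst (A * Bᴴ) := by
  ext i j
  simp [envFst, trFst, Matrix.mul_apply, Fintype.sum_prod_type]

lemma hsInner_envFst (A B : Matrix (m × e) f ℂ) : hsInner (envFst A) (envFst B) = hsInner A B := by
  unfold hsInner
  congr 1
  simp only [envFst, trace, Matrix.diag, Matrix.mul_apply, Fintype.sum_prod_type,
    conjTranspose_apply]
  rw [Finset.sum_comm]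

lemma envFst_kronecker_mul [DecidableEq e] (S : Matrix m m ℂ) (Y : Matrix e e ℂ)
    (K : Matrix (m × e) f ℂ) :
    envFst ((S ⊗ₖ Y) * K) = Y * envFst ((S ⊗ₖ (1 : Matrix e e ℂ)) * K) := by
  ext i j
  simp only [envFst, Matrix.mul_apply, Fintype.sum_prod_type, kronecker_apply, Matrix.one_apply,
    mul_ite, mul_one, mul_zero, ite_mul, zero_mul, Finset.sum_ite_eq, Finset.mem_univ, if_true,
    Finset.mul_sum]
  rw [Finset.sum_comm]
  refine Finset.sum_congr rfl fun _ _ => Finset.sum_congr rfl fun _ _ => by ring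

lemma trFst_posSemidef {ρ : Matrix (m × e) (m × e) ℂ} (h : ρ.PosSemidef) :
    (trFst ρ).PosSemidef := by
  have : trFst ρ = ∑ k, ρ.submatrix (fun j => (k, j)) (fun j => (k, j)) := by
    ext i j; simp [trFst, Matrix.sum_apply]
  rw [this]
  exact posSemidef_sum _ fun k _ => h.submatrix _

lemma trFst_kronecker (ρ : Matrix m m ℂ) (σ : Matrix e e ℂ) :
    trFst (ρ ⊗ₖ σ) = ρ.trace • σ := by
  ext i j; simp [trFst, trace, Finset.sum_mul]

lemma sqrt_kronecker [DecidableEq e] [DecidableEq m] {ρ : Matrix m m ℂ} {σ : Matrix e e ℂ}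
    (hρ : ρ.PosSemidef) (hσ : σ.PosSemidef) : CFC.sqrt (ρ ⊗ₖ σ) = CFC.sqrt ρ ⊗ₖ CFC.sqrt σ := by
  refine sqrt_eq_of_mul_self ?_ ((sqrt_posSemidef ρ).kronecker (sqrt_posSemidef σ))
  rw [← mul_kronecker_mul, sqrt_mul_self_eq hρ, sqrt_mul_self_eq hσ]

/-- Tracing out `m` from the positive operator `(S ⊗ 1) (1 - K Kᴴ) (S ⊗ 1)ᴴ` leaves exactly the
defect, since `S Sᴴ` has trace one. -/
lemma isContr_envFst [DecidableEq m] [DecidableEq e] [DecidableEq f] {S : Matrix m m ℂ}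
    (hS : (S * Sᴴ).trace = 1) {K : Matrix (m × e) f ℂ} (hK : IsContr K) :
    IsContr (envFst ((S ⊗ₖ (1 : Matrix e e ℂ)) * K))ᴴ := by
  have hK' := hK.conjTranspose
  unfold IsContr at hK' ⊢
  rw [conjTranspose_conjTranspose] at hK' ⊢
  rw [envFst_mul_conjTranspose]
  have h1 := trFst_posSemidef (hK'.mul_mul_conjTranspose_same (S ⊗ₖ (1 : Matrix e e ℂ)))
  convert h1 using 1
  have h2 : trFst ((S ⊗ₖ (1 : Matrix e e ℂ)) * (S ⊗ₖ (1 : Matrix e e ℂ))ᴴ) = 1 := by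
    rw [conjTranspose_kronecker, ← mul_kronecker_mul, trFst_kronecker, hS]
    simp
  have h3 : ∀ X Y : Matrix (m × e) (m × e) ℂ, trFst (X - Y) = trFst X - trFst Y := by
    intro X Y; ext i j; simp [trFst]
  rw [Matrix.mul_sub, Matrix.sub_mul, Matrix.mul_one, h3, h2, conjTranspose_mul]
  simp only [Matrix.mul_assoc]

lemma isContr_one_kronecker [DecidableEq m] [DecidableEq e] [DecidableEq f] {C : Matrix e f ℂ}
    (hC : IsContr C) : IsContr ((1 : Matrix m m ℂ) ⊗ₖ C) := by
  unfold IsContr at hC ⊢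
  have h := (PosSemidef.one (n := m) (R := ℂ)).kronecker hC
  suffices heq : 1 - ((1 : Matrix m m ℂ) ⊗ₖ C)ᴴ * ((1 : Matrix m m ℂ) ⊗ₖ C) =
      (1 : Matrix m m ℂ) ⊗ₖ (1 - Cᴴ * C) by rw [heq]; exact h
  rw [conjTranspose_kronecker, ← mul_kronecker_mul]
  ext ⟨i, j⟩ ⟨k, l⟩
  simp only [Matrix.sub_apply, kronecker_apply, Matrix.one_apply, Prod.mk.injEq,
    conjTranspose_one, Matrix.mul_one]
  split_ifs <;> simp_all

end KeyInequality

/-! ### The purified distance: triangle inequality and the `3ε` estimate. -/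

section PurifiedDistance

variable {p e m : Type*} [Fintype p] [DecidableEq p] [Fintype e] [DecidableEq e]
  [Fintype m] [DecidableEq m]

lemma fidelity_nonneg (ρ σ : Matrix p p ℂ) : 0 ≤ fidelity ρ σ :=
  (Complex.nonneg_iff.1 (sqrt_posSemidef _).trace_nonneg).1

lemma le_fidelity_sq_of_purifiedDist_le {ρ σ : Matrix p p ℂ} {ε : ℝ} (h : purifiedDist ρ σ ≤ ε) :
    1 - ε ^ 2 ≤ fidelity ρ σ ^ 2 := by
  have h0 : 0 ≤ ε := (Real.sqrt_nonneg _).trans h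
  have := (Real.sqrt_le_left h0).1 h
  linarith

lemma purifiedDist_le_of {ρ σ : Matrix p p ℂ} {ε : ℝ} (hε : 0 ≤ ε)
    (h : 1 - ε ^ 2 ≤ fidelity ρ σ ^ 2) : purifiedDist ρ σ ≤ ε :=
  (Real.sqrt_le_left hε).2 (by linarith)

lemma purifiedDist_anti {p' : Type*} [Fintype p'] [DecidableEq p'] {ρ σ : Matrix p p ℂ}
    {ρ' σ' : Matrix p' p' ℂ} (h : fidelity ρ σ ≤ fidelity ρ' σ') :
    purifiedDist ρ' σ' ≤ purifiedDist ρ σ :=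
  Real.sqrt_le_sqrt (by nlinarith [fidelity_nonneg ρ σ])

lemma hsInner_sqrt_self {ρ : Matrix p p ℂ} (h : IsState ρ) :
    hsInner (CFC.sqrt ρ) (CFC.sqrt ρ) = 1 := by
  rw [hsInner, sqrt_conjTranspose, sqrt_mul_self_eq h.1, h.2, Complex.one_re]

lemma exists_contr_fidelity_sqrt {f : Type*} [Fintype f] [DecidableEq f] (A : Matrix p f ℂ)
    {σ : Matrix p p ℂ} (hσ : σ.PosSemidef) : ∃ K : Matrix p f ℂ, IsContr K ∧
      hsInner A (CFC.sqrt σ * K) = fidelity (A * Aᴴ) σ := by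
  obtain ⟨K, hK, h⟩ := exists_contr_fidelity A (CFC.sqrt σ)
  exact ⟨K, hK, by rw [h, sqrt_mul_conjTranspose hσ]⟩

lemma purifiedDist_self {ρ : Matrix p p ℂ} (h : IsState ρ) : purifiedDist ρ ρ = 0 := by
  have h1 := le_fidelity (CFC.sqrt ρ) (CFC.sqrt ρ) (IsContr.of_isometry (K := (1 : Matrix p p ℂ))
    (by simp))
  rw [Matrix.mul_one, hsInner_sqrt_self h, sqrt_mul_conjTranspose h.1] at h1
  exact le_antisymm (purifiedDist_le_of le_rfl (by nlinarith)) (Real.sqrt_nonneg _)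

/-- The triangle inequality, for two equal bounds. -/
lemma purifiedDist_le_two_mul {ρ₀ ρ η : Matrix p p ℂ} {ε : ℝ} (hρ₀ : IsState ρ₀)
    (hρ : IsState ρ) (hη : IsState η) (h₀ : purifiedDist ρ ρ₀ ≤ ε) (h₁ : purifiedDist ρ η ≤ ε) :
    purifiedDist ρ₀ η ≤ 2 * ε := by
  have hε : 0 ≤ ε := (Real.sqrt_nonneg _).trans h₀
  refine purifiedDist_le_of (by linarith) ?_
  obtain ⟨K₀, hK₀, e₀⟩ := exists_contr_fidelity_sqrt (CFC.sqrt ρ) hρ₀.1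
  obtain ⟨K₁, hK₁, e₁⟩ := exists_contr_fidelity_sqrt (CFC.sqrt ρ) hη.1
  rw [sqrt_mul_conjTranspose hρ.1] at e₀ e₁
  have f₀ := le_fidelity_sq_of_purifiedDist_le h₀
  have f₁ := le_fidelity_sq_of_purifiedDist_le h₁
  rw [← e₀, hsInner_comm] at f₀
  rw [← e₁] at f₁
  have hF := le_hsInner_of_le (hsInner_sqrt_self hρ)
    ((hK₀.hsInner_mul_right_le _).trans (hsInner_sqrt_self hρ₀).le)
    ((hK₁.hsInner_mul_right_le _).trans (hsInner_sqrt_self hη).le)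
    (by rw [hsInner_comm, e₀]; exact fidelity_nonneg _ _) f₀
    (by rw [e₁]; exact fidelity_nonneg _ _) f₁
  rw [hsInner_mul_right_left, Matrix.mul_assoc] at hF
  have hF' := hF.trans (le_fidelity (CFC.sqrt ρ₀) (CFC.sqrt η) (hK₁.mul hK₀.conjTranspose))
  rw [sqrt_mul_conjTranspose hρ₀.1, sqrt_mul_conjTranspose hη.1] at hF'
  have hn := fidelity_nonneg ρ₀ η
  -- The overlap bound squares to `(1 - 2ε²)² ≥ 1 - (2ε)²`; if `1 - 2ε²` is negative, so is the
  -- right-hand side.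
  rcases le_total 0 (1 - 2 * ε ^ 2) with h | h
  · nlinarith
  · nlinarith [sq_nonneg (fidelity ρ₀ η)]

/-- A state `ξ₀` on `M E` close to a state that is close to a product state and has an `E`-marginal
close to `ζ` is itself close to a product state with `E`-marginal `ζ`. -/
lemma purifiedDist_kronecker_le {ξ₀ ξ : Matrix (m × e) (m × e) ℂ} {ω : Matrix m m ℂ}
    {τ ζ : Matrix e e ℂ} {ε : ℝ} (hξ₀ : IsState ξ₀) (hξ : IsState ξ) (hω : IsState ω)
    (hτ : IsState τ) (hζ : IsState ζ) (h₀ : purifiedDist ξ ξ₀ ≤ ε)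
    (h₁ : purifiedDist ξ (ω ⊗ₖ τ) ≤ ε) (h₂ : purifiedDist (trFst ξ) ζ ≤ ε) :
    purifiedDist ξ₀ (ω ⊗ₖ ζ) ≤ 3 * ε := by
  have hε : 0 ≤ ε := (Real.sqrt_nonneg _).trans h₀
  refine purifiedDist_le_of (by linarith) ?_
  -- When `3ε ≥ 1` there is nothing to prove; otherwise `ε² ≤ 1/9`, so the overlap bound `1 - 4ε²`
  -- is positive and may be squared.
  rcases le_total 1 (9 * ε ^ 2) with hbig | hsmall
  · nlinarith [sq_nonneg (fidelity ξ₀ (ω ⊗ₖ ζ))]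
  obtain ⟨K₀, hK₀, e₀⟩ := exists_contr_fidelity_sqrt (CFC.sqrt ξ) hξ₀.1
  obtain ⟨K, hK, e₁⟩ := exists_contr_fidelity_sqrt (CFC.sqrt ξ) (hω.1.kronecker hτ.1)
  obtain ⟨L, hL, e₂⟩ := exists_contr_fidelity_sqrt (envFst (CFC.sqrt ξ)) hζ.1
  rw [sqrt_mul_conjTranspose hξ.1] at e₀ e₁
  rw [envFst_mul_conjTranspose, sqrt_mul_conjTranspose hξ.1] at e₂
  rw [sqrt_kronecker hω.1 hτ.1] at e₁
  have f₀ := le_fidelity_sq_of_purifiedDist_le h₀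
  have f₁ := le_fidelity_sq_of_purifiedDist_le h₁
  have f₂ := le_fidelity_sq_of_purifiedDist_le h₂
  have hSω : (CFC.sqrt ω * (CFC.sqrt ω)ᴴ).trace = 1 := by rw [sqrt_mul_conjTranspose hω.1, hω.2]
  -- With `m` in the environment, the optimal amplitude `(√ω ⊗ √τ) K` of the product state reads `√τ
  -- * M`. Since `M` does not involve `τ`, it can be reused for `ζ`.
  set M := envFst ((CFC.sqrt ω ⊗ₖ (1 : Matrix e e ℂ)) * K) with hM
  have hMc : IsContr Mᴴ := isContr_envFst hSω hK
  -- `Mᴴ` nearly preserves the amplitude of `ξ`: moved across the inner product, it gives overlap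
  -- `F(ξ, ω ⊗ τ)` with the unit vector `√τ`.
  have hNx : 1 - ε ^ 2 ≤ hsInner (envFst (CFC.sqrt ξ) * Mᴴ) (envFst (CFC.sqrt ξ) * Mᴴ) := by
    refine le_trans ?_ (hsInner_sq_le (hsInner_sqrt_self hτ))
    rw [hsInner_comm, hsInner_mul_right_left, conjTranspose_conjTranspose, hM,
      ← envFst_kronecker_mul, hsInner_envFst, e₁]
    exact f₁
  have hF := le_hsInner_mul_of_le (x := envFst (CFC.sqrt ξ)) (x₀ := envFst (CFC.sqrt ξ₀ * K₀))
    (z := CFC.sqrt ζ * L) hMc (t := ε ^ 2) (by linarith)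
    (by rw [hsInner_envFst, hsInner_sqrt_self hξ])
    (by rw [hsInner_envFst]; exact (hK₀.hsInner_mul_right_le _).trans (hsInner_sqrt_self hξ₀).le)
    ((hL.hsInner_mul_right_le _).trans (hsInner_sqrt_self hζ).le)
    (by rw [hsInner_envFst, hsInner_comm, e₀]; exact fidelity_nonneg _ _)
    (by rw [hsInner_envFst, hsInner_comm, e₀]; exact f₀)
    (by rw [e₂]; exact fidelity_nonneg _ _) (by rw [e₂]; exact f₂) hNx
  -- Moving `Mᴴ` back puts `M` to the right of `√ζ L Mᴴ`, which restores the factor `√ω`. The result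
  -- is an overlap of amplitudes of `ξ₀` and `ω ⊗ ζ` through a contraction.
  have hprod : hsInner (envFst (CFC.sqrt ξ₀ * K₀) * Mᴴ) (CFC.sqrt ζ * L * Mᴴ) =
      hsInner (CFC.sqrt ξ₀) ((CFC.sqrt ω ⊗ₖ CFC.sqrt ζ) *
        (((1 : Matrix m m ℂ) ⊗ₖ (L * Mᴴ)) * K * K₀ᴴ)) := by
    rw [hsInner_mul_right_left, conjTranspose_conjTranspose, Matrix.mul_assoc (CFC.sqrt ζ), hM,
      ← envFst_kronecker_mul, hsInner_envFst, hsInner_mul_right_left, ← hM]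
    have h : CFC.sqrt ω ⊗ₖ (CFC.sqrt ζ * (L * Mᴴ)) =
        (CFC.sqrt ω ⊗ₖ CFC.sqrt ζ) * ((1 : Matrix m m ℂ) ⊗ₖ (L * Mᴴ)) := by
      rw [← mul_kronecker_mul, Matrix.mul_one]
    rw [h]
    simp only [Matrix.mul_assoc]
  rw [hprod] at hF
  have hF' := hF.trans (le_fidelity (CFC.sqrt ξ₀) (CFC.sqrt ω ⊗ₖ CFC.sqrt ζ)
    (((isContr_one_kronecker (hL.mul hMc)).mul hK).mul hK₀.conjTranspose))
  rw [← sqrt_kronecker hω.1 hζ.1, sqrt_mul_conjTranspose hξ₀.1,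
    sqrt_mul_conjTranspose (hω.1.kronecker hζ.1)] at hF'
  have h1 : 0 ≤ 1 - 4 * ε ^ 2 := by nlinarith
  have h2 : (1 - 4 * ε ^ 2) ^ 2 ≤ fidelity ξ₀ (ω ⊗ₖ ζ) ^ 2 := pow_le_pow_left₀ h1 hF' 2
  nlinarith [sq_nonneg (ε ^ 2), sq_nonneg ε]

end PurifiedDistance

/-! ### How the operations on states act on amplitudes. -/

section Amplitudes

variable {p q f g a a' b e : Type*} [Fintype p] [Fintype q] [Fintype f] [Fintype g]
  [Fintype a] [Fintype a'] [Fintype b] [Fintype e]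

/-- The amplitude matrix with the second tensor factor moved to the environment. -/
def envSnd (A : Matrix (a × b) f ℂ) : Matrix a (b × f) ℂ := fun i x => A (i, x.1) x.2

lemma envSnd_mul_conjTranspose (A B : Matrix (a × b) f ℂ) :
    envSnd A * (envSnd B)ᴴ = trSnd (A * Bᴴ) := by
  ext i j
  simp [envSnd, trSnd, Matrix.mul_apply, Fintype.sum_prod_type]

lemma hsInner_envSnd (A B : Matrix (a × b) f ℂ) : hsInner (envSnd A) (envSnd B) = hsInner A B := by
  unfold hsInner
  congr 1
  simp only [envSnd, trace, Matrix.diag, Matrix.mul_apply, Fintype.sum_prod_type,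
    conjTranspose_apply]
  rw [Finset.sum_comm]
  exact Finset.sum_congr rfl fun _ _ => Finset.sum_comm

lemma submatrix_mul_conjTranspose (A : Matrix p f ℂ) (h : q → p) :
    (A * Aᴴ).submatrix h h = A.submatrix h id * (A.submatrix h id)ᴴ := rfl

lemma mul_conjTranspose_submatrix (A : Matrix p f ℂ) (h : g ≃ f) :
    A.submatrix id h * (A.submatrix id h)ᴴ = A * Aᴴ := by
  rw [conjTranspose_submatrix, submatrix_mul_equiv, submatrix_id_id]

lemma kronecker_mul_conjTranspose (A : Matrix p f ℂ) (B : Matrix q g ℂ) :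
    (A * Aᴴ) ⊗ₖ (B * Bᴴ) = (A ⊗ₖ B) * (A ⊗ₖ B)ᴴ := by
  rw [conjTranspose_kronecker, mul_kronecker_mul]

lemma conjFst_mul_conjTranspose [DecidableEq e] (V : Matrix a' a ℂ) (A : Matrix (a × e) f ℂ) :
    conjFst V (A * Aᴴ) = ((V ⊗ₖ (1 : Matrix e e ℂ)) * A) * ((V ⊗ₖ (1 : Matrix e e ℂ)) * A)ᴴ := by
  simp only [conjFst, conjTranspose_mul, Matrix.mul_assoc]

lemma hsInner_kronecker (A B : Matrix p f ℂ) {S : Matrix q g ℂ} (hS : (S * Sᴴ).trace = 1) :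
    hsInner (A ⊗ₖ S) (B ⊗ₖ S) = hsInner A B := by
  rw [trace_mul_comm] at hS
  rw [hsInner, conjTranspose_kronecker, ← mul_kronecker_mul, trace_kronecker, hS, mul_one, hsInner]

lemma hsInner_mul_left_isometry [DecidableEq p] {W : Matrix q p ℂ} (hW : Wᴴ * W = 1)
    (A B : Matrix p f ℂ) : hsInner (W * A) (W * B) = hsInner A B := by
  simp only [hsInner, conjTranspose_mul]
  rw [Matrix.mul_assoc, ← Matrix.mul_assoc Wᴴ, hW, Matrix.one_mul]

lemma hsInner_submatrix (h : q ≃ p) (A B : Matrix p f ℂ) :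
    hsInner (A.submatrix h id) (B.submatrix h id) = hsInner A B := by
  rw [hsInner, conjTranspose_submatrix, submatrix_mul_equiv, submatrix_id_id, hsInner]

lemma isometry_kronecker_one [DecidableEq a] [DecidableEq e] {V : Matrix a' a ℂ} (hV : Vᴴ * V = 1) :
    (V ⊗ₖ (1 : Matrix e e ℂ))ᴴ * (V ⊗ₖ (1 : Matrix e e ℂ)) = 1 := by
  rw [conjTranspose_kronecker, ← mul_kronecker_mul, hV]
  simp

end Amplitudes

/-! ### Monotonicity of the fidelity and the catalytic decoupling step. -/

section States

variable {p q a a' b e : Type*} [Fintype p] [Fintype q]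
  [Fintype a] [Fintype a'] [Fintype b] [Fintype e]
  [DecidableEq p] [DecidableEq q]
  [DecidableEq a] [DecidableEq a'] [DecidableEq b] [DecidableEq e]

lemma trSnd_posSemidef {ρ : Matrix (a × b) (a × b) ℂ} (h : ρ.PosSemidef) :
    (trSnd ρ).PosSemidef := by
  rw [← sqrt_mul_conjTranspose h, ← envSnd_mul_conjTranspose]
  exact posSemidef_self_mul_conjTranspose _

lemma IsState.trSnd {ρ : Matrix (a × b) (a × b) ℂ} (h : IsState ρ) : IsState (trSnd ρ) :=
  ⟨trSnd_posSemidef h.1, by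
    rw [← h.2]; simp [QI.trSnd, trace, Fintype.sum_prod_type]⟩

lemma IsState.trFst {ρ : Matrix (a × b) (a × b) ℂ} (h : IsState ρ) : IsState (trFst ρ) :=
  ⟨trFst_posSemidef h.1, by
    rw [← h.2]; simp only [QI.trFst, trace, Fintype.sum_prod_type, Matrix.diag]
    exact Finset.sum_comm⟩

lemma IsState.kronecker {ρ : Matrix p p ℂ} {σ : Matrix q q ℂ} (hρ : IsState ρ) (hσ : IsState σ) :
    IsState (ρ ⊗ₖ σ) :=
  ⟨hρ.1.kronecker hσ.1, by rw [trace_kronecker, hρ.2, hσ.2, mul_one]⟩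

lemma IsState.submatrix {ρ : Matrix p p ℂ} (hρ : IsState ρ) (h : q ≃ p) :
    IsState (ρ.submatrix h h) :=
  ⟨hρ.1.submatrix h, by rw [← hρ.2]; exact h.sum_comp fun i => ρ i i⟩

lemma IsState.conjFst {ρ : Matrix (a × e) (a × e) ℂ} (hρ : IsState ρ) {V : Matrix a' a ℂ}
    (hV : Vᴴ * V = 1) : IsState (conjFst V ρ) := by
  refine ⟨hρ.1.mul_mul_conjTranspose_same _, ?_⟩
  rw [QI.conjFst, trace_mul_comm, ← Matrix.mul_assoc, isometry_kronecker_one hV, Matrix.one_mul,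
    hρ.2]

lemma exists_amplitudes {ρ σ : Matrix p p ℂ} (hρ : ρ.PosSemidef) (hσ : σ.PosSemidef) :
    ∃ A B K : Matrix p p ℂ, IsContr K ∧ ρ = A * Aᴴ ∧ σ = B * Bᴴ ∧
      fidelity ρ σ = hsInner A (B * K) := by
  obtain ⟨K, hK, h⟩ := exists_contr_fidelity_sqrt (CFC.sqrt ρ) hσ
  rw [sqrt_mul_conjTranspose hρ] at h
  exact ⟨_, _, K, hK, (sqrt_mul_conjTranspose hρ).symm, (sqrt_mul_conjTranspose hσ).symm, h.symm⟩

/-- Discarding `b` moves it to the environment, where the optimal contraction `K` becomes `1 ⊗ K`.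
-/
lemma fidelity_le_trSnd {ρ σ : Matrix (a × b) (a × b) ℂ} (hρ : ρ.PosSemidef)
    (hσ : σ.PosSemidef) : fidelity ρ σ ≤ fidelity (trSnd ρ) (trSnd σ) := by
  obtain ⟨A, B, K, hK, rfl, rfl, h⟩ := exists_amplitudes hρ hσ
  rw [h, ← hsInner_envSnd, ← envSnd_mul_conjTranspose, ← envSnd_mul_conjTranspose]
  refine le_trans (le_of_eq ?_) (le_fidelity _ _ (isContr_one_kronecker (m := b) hK))
  congr 1
  ext i ⟨j, k⟩
  simp [envSnd, Matrix.mul_apply, Fintype.sum_prod_type, Matrix.one_apply]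

lemma fidelity_le_conjFst {ρ σ : Matrix (a × e) (a × e) ℂ} (hρ : ρ.PosSemidef)
    (hσ : σ.PosSemidef) {V : Matrix a' a ℂ} (hV : Vᴴ * V = 1) :
    fidelity ρ σ ≤ fidelity (conjFst V ρ) (conjFst V σ) := by
  obtain ⟨A, B, K, hK, rfl, rfl, h⟩ := exists_amplitudes hρ hσ
  rw [h, conjFst_mul_conjTranspose, conjFst_mul_conjTranspose,
    ← hsInner_mul_left_isometry (isometry_kronecker_one (e := e) hV), ← Matrix.mul_assoc]
  exact le_fidelity _ _ hK

lemma fidelity_le_kronecker {ρ σ : Matrix p p ℂ} (hρ : ρ.PosSemidef) (hσ : σ.PosSemidef)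
    {ω : Matrix q q ℂ} (hω : IsState ω) : fidelity ρ σ ≤ fidelity (ρ ⊗ₖ ω) (σ ⊗ₖ ω) := by
  obtain ⟨A, B, K, hK, rfl, rfl, h⟩ := exists_amplitudes hρ hσ
  have hS := sqrt_mul_conjTranspose hω.1
  have hK' : IsContr (K ⊗ₖ (1 : Matrix q q ℂ)) := by
    have h := hK.kronecker (PosSemidef.one (n := q) (R := ℂ))
    suffices heq : 1 - (K ⊗ₖ (1 : Matrix q q ℂ))ᴴ * (K ⊗ₖ (1 : Matrix q q ℂ)) =
        (1 - Kᴴ * K) ⊗ₖ (1 : Matrix q q ℂ) by rw [IsContr, heq]; exact h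
    rw [conjTranspose_kronecker, ← mul_kronecker_mul]
    ext ⟨i, j⟩ ⟨k, l⟩
    simp only [Matrix.sub_apply, kronecker_apply, Matrix.one_apply, Prod.mk.injEq,
      conjTranspose_one, Matrix.mul_one]
    split_ifs <;> simp_all
  rw [h, ← hS, kronecker_mul_conjTranspose, kronecker_mul_conjTranspose,
    ← hsInner_kronecker (S := CFC.sqrt ω) _ _ (by rw [hS, hω.2])]
  refine le_trans (le_of_eq ?_) (le_fidelity _ _ hK')
  rw [← mul_kronecker_mul, Matrix.mul_one]

lemma fidelity_le_submatrix {ρ σ : Matrix p p ℂ} (hρ : ρ.PosSemidef) (hσ : σ.PosSemidef)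
    (r : q ≃ p) : fidelity ρ σ ≤ fidelity (ρ.submatrix r r) (σ.submatrix r r) := by
  obtain ⟨A, B, K, hK, rfl, rfl, h⟩ := exists_amplitudes hρ hσ
  rw [h, submatrix_mul_conjTranspose, submatrix_mul_conjTranspose, ← hsInner_submatrix r]
  exact le_fidelity _ _ hK

/-- `(x y) z ≃ (x z) y`. -/
def prodSwapRight (x y z : Type*) : (x × y) × z ≃ (x × z) × y where
  toFun u := ((u.1.1, u.2), u.1.2)
  invFun u := ((u.1.1, u.2), u.1.2)

/-- The state after a catalytic decoupling step. -/
def catOut {n m d : ℕ} (V : Matrix (Fin m × Fin d) (a × Fin n) ℂ)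
    (ρ : Matrix (a × e) (a × e) ℂ) (σ : Matrix (Fin n) (Fin n) ℂ) :
    Matrix (Fin m × e) (Fin m × e) ℂ :=
  trSnd ((conjFst V ((ρ ⊗ₖ σ).submatrix (prodSwapRight a (Fin n) e)
    (prodSwapRight a (Fin n) e))).submatrix (prodSwapRight (Fin m) e (Fin d))
      (prodSwapRight (Fin m) e (Fin d)))

lemma IsState.catOut {n m d : ℕ} {V : Matrix (Fin m × Fin d) (a × Fin n) ℂ} (hV : Vᴴ * V = 1)
    {ρ : Matrix (a × e) (a × e) ℂ} (hρ : IsState ρ) {σ : Matrix (Fin n) (Fin n) ℂ}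
    (hσ : IsState σ) : IsState (catOut V ρ σ) :=
  (((((hρ.kronecker hσ).submatrix _).conjFst hV).submatrix _)).trSnd

lemma purifiedDist_catOut_le {n m d : ℕ} {V : Matrix (Fin m × Fin d) (a × Fin n) ℂ}
    (hV : Vᴴ * V = 1) {ρ ρ' : Matrix (a × e) (a × e) ℂ} (hρ : IsState ρ) (hρ' : IsState ρ')
    {σ : Matrix (Fin n) (Fin n) ℂ} (hσ : IsState σ) :
    purifiedDist (catOut V ρ σ) (catOut V ρ' σ) ≤ purifiedDist ρ ρ' := by
  have s₁ := hρ.kronecker hσ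
  have s₁' := hρ'.kronecker hσ
  have s₂ := s₁.submatrix (prodSwapRight a (Fin n) e)
  have s₂' := s₁'.submatrix (prodSwapRight a (Fin n) e)
  have s₃ := s₂.conjFst hV
  have s₃' := s₂'.conjFst hV
  have s₄ := s₃.submatrix (prodSwapRight (Fin m) e (Fin d))
  have s₄' := s₃'.submatrix (prodSwapRight (Fin m) e (Fin d))
  exact purifiedDist_anti <| (fidelity_le_kronecker hρ.1 hρ'.1 hσ).trans <|
    (fidelity_le_submatrix s₁.1 s₁'.1 _).trans <| (fidelity_le_conjFst s₂.1 s₂'.1 hV).trans <|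
    (fidelity_le_submatrix s₃.1 s₃'.1 _).trans <| fidelity_le_trSnd s₄.1 s₄'.1

/-- An isometry preserves inner products of vectors on `a`, and each entry of the marginal is a sum
of such products over the columns of an amplitude. -/
lemma trFst_conjFst {V : Matrix a' a ℂ} (hV : Vᴴ * V = 1) {ρ : Matrix (a × e) (a × e) ℂ}
    (hρ : ρ.PosSemidef) : trFst (conjFst V ρ) = trFst ρ := by
  obtain ⟨A, rfl⟩ : ∃ A, ρ = A * Aᴴ := ⟨_, (sqrt_mul_conjTranspose hρ).symm⟩
  rw [conjFst_mul_conjTranspose]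
  ext i j
  have key : ∀ x, ∑ k, ((V ⊗ₖ (1 : Matrix e e ℂ)) * A) (k, i) x *
      star (((V ⊗ₖ (1 : Matrix e e ℂ)) * A) (k, j) x) = ∑ k, A (k, i) x * star (A (k, j) x) := by
    intro x
    have h1 : ∀ k l, ((V ⊗ₖ (1 : Matrix e e ℂ)) * A) (k, l) x = (V *ᵥ fun k => A (k, l) x) k := by
      intro k l
      simp [Matrix.mul_apply, mulVec, dotProduct, Fintype.sum_prod_type, Matrix.one_apply]
    have h2 : star (V *ᵥ fun k => A (k, j) x) ⬝ᵥ (V *ᵥ fun k => A (k, i) x) =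
        star (fun k => A (k, j) x) ⬝ᵥ (fun k => A (k, i) x) := by
      rw [star_mulVec, ← dotProduct_mulVec, mulVec_mulVec, hV, one_mulVec]
    simp only [h1]
    simpa [dotProduct, mul_comm] using h2
  simp only [trFst, Matrix.mul_apply, conjTranspose_apply]
  rw [Finset.sum_comm, Finset.sum_comm (γ := a)]
  exact Finset.sum_congr rfl fun x _ => key x

lemma trFst_catOut {n m d : ℕ} {V : Matrix (Fin m × Fin d) (a × Fin n) ℂ} (hV : Vᴴ * V = 1)
    {ρ : Matrix (a × e) (a × e) ℂ} (hρ : IsState ρ) {σ : Matrix (Fin n) (Fin n) ℂ}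
    (hσ : IsState σ) : trFst (catOut V ρ σ) = trFst ρ := by
  have h1 := trFst_conjFst hV ((hρ.kronecker hσ).submatrix (prodSwapRight a (Fin n) e)).1
  have h2 : trFst (catOut V ρ σ) = trFst (conjFst V ((ρ ⊗ₖ σ).submatrix
      (prodSwapRight a (Fin n) e) (prodSwapRight a (Fin n) e))) := by
    ext i j
    simp [trFst, catOut, trSnd, prodSwapRight, Fintype.sum_prod_type]
  rw [h2, h1]
  ext i j
  have h3 : ∑ k, σ k k = 1 := hσ.2
  simp only [trFst, prodSwapRight, Equiv.coe_fn_mk, submatrix_apply, kronecker_apply,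
    Fintype.sum_prod_type, ← Finset.mul_sum, h3, mul_one]

end States

/-! ### Pure states, and channels with a prescribed Kraus operator. -/

section Kets

variable {p q e : Type*} [Fintype p] [Fintype q] [Fintype e]
  [DecidableEq p] [DecidableEq q] [DecidableEq e]

lemma conjFst_ketbra (V : Matrix q p ℂ) (v : p × e → ℂ) :
    conjFst V (ketbra v) = ketbra ((V ⊗ₖ (1 : Matrix e e ℂ)) *ᵥ v) := by
  rw [conjFst, ketbra, ketbra, mul_vecMulVec, vecMulVec_mul, star_mulVec]

lemma ketbra_kronecker (v : p → ℂ) (w : q → ℂ) :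
    ketbra v ⊗ₖ ketbra w = ketbra (fun x : p × q => v x.1 * w x.2) := by
  ext ⟨i, j⟩ ⟨k, l⟩
  simp only [ketbra, kronecker_apply, vecMulVec_apply, Pi.star_apply, star_mul']
  ring

/-- The fidelity of a mixture of vectors with a pure state is at least every overlap. -/
lemma re_dotProduct_le_fidelity {N : ℕ} (w : Fin N → p → ℂ) (t : p → ℂ) (k₀ : Fin N) :
    (star (w k₀) ⬝ᵥ t).re ≤ fidelity (∑ k, ketbra (w k)) (ketbra t) := by
  let A : Matrix p (Fin N) ℂ := Matrix.of fun i k => w k i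
  let B : Matrix p Unit ℂ := Matrix.of fun i _ => t i
  let K : Matrix Unit (Fin N) ℂ := Matrix.of fun _ k => if k = k₀ then 1 else 0
  have hA : ∑ k, ketbra (w k) = A * Aᴴ := by
    ext i j; simp [ketbra, vecMulVec_apply, Matrix.mul_apply, Matrix.sum_apply, A]
  have hB : ketbra t = B * Bᴴ := by
    ext i j; simp [ketbra, vecMulVec_apply, Matrix.mul_apply, B]
  -- `K` selects the environment label `k₀`; its adjoint is an isometry.
  have hK : IsContr K := by
    rw [← conjTranspose_conjTranspose K]
    refine (IsContr.of_isometry ?_).conjTranspose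
    ext i j; simp [K, Matrix.mul_apply]
  rw [hA, hB]
  refine le_trans (le_of_eq ?_) (le_fidelity A B hK)
  simp [hsInner, trace, Matrix.mul_apply, dotProduct, A, B, K]

/-- Every contraction is a Kraus operator of some channel. -/
lemma exists_channel_kraus [Nonempty q] {K : Matrix q p ℂ} (hK : IsContr K) :
    ∃ (Φ : Channel p q) (k₀ : Fin Φ.rank), Φ.kraus k₀ = K := by
  obtain ⟨o⟩ := ‹Nonempty q›
  let ι := Fintype.equivFin p
  let S := CFC.sqrt (1 - Kᴴ * K)
  -- The defect `1 - Kᴴ K = Sᴴ S` is split over the rows of `S`, each sent to the fixed output label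
  -- `o`. This works whatever the dimensions of `p` and `q` are.
  let L : Fin (Fintype.card p) → Matrix q p ℂ := fun j =>
    Matrix.of fun x y => if x = o then S (ι.symm j) y else 0
  have hL : ∑ j, (L j)ᴴ * L j = 1 - Kᴴ * K := by
    have hS : Sᴴ * S = 1 - Kᴴ * K := by
      rw [sqrt_conjTranspose, sqrt_mul_self_eq hK]
    rw [← hS]
    ext x y
    simp only [Matrix.sum_apply, Matrix.mul_apply, conjTranspose_apply, L]
    rw [← ι.symm.sum_comp fun z => star (S z x) * S z y]
    refine Finset.sum_congr rfl fun j _ => ?_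
    simp
  refine ⟨⟨Fintype.card p + 1, Fin.cons K L, ?_⟩, (0 : Fin (Fintype.card p + 1)), rfl⟩
  rw [Fin.sum_univ_succ]
  simp only [Fin.cons_zero, Fin.cons_succ, hL]
  abel

end Kets

/-! ### The protocol with an isometric encoder. -/

section Protocol

variable {a b c r : Type*} [Fintype a] [DecidableEq a] [Fintype b] [DecidableEq b]
  [Fintype c] [DecidableEq c] [Fintype r] [DecidableEq r]

/-- The channel given by a single isometry. -/
def isometryChannel {p q : Type*} [Fintype p] [DecidableEq p] [Fintype q] (E : Matrix q p ℂ)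
    (hE : Eᴴ * E = 1) : Channel p q :=
  ⟨1, fun _ => E, by simp [hE]⟩

lemma onFst_isometryChannel {p q e : Type*} [Fintype p] [DecidableEq p] [Fintype q] [Fintype e]
    [DecidableEq e] {E : Matrix q p ℂ} (hE : Eᴴ * E = 1) (ρ : Matrix (p × e) (p × e) ℂ) :
    (isometryChannel E hE).onFst ρ = conjFst E ρ := by
  change ∑ _k : Fin 1, conjFst E ρ = conjFst E ρ
  simp

lemma ketbra_submatrix {p q : Type*} (v : p → ℂ) (f : q → p) :
    (ketbra v).submatrix f f = ketbra fun x => v (f x) := rfl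

/-- The state vector after the encoding isometry `E` has been applied. -/
def encodedKet {k l k' d : ℕ} (ψ : a × b × c × r → ℂ) (φ : Fin k × Fin l → ℂ)
    (E : Matrix (a × Fin k' × Fin d) (a × c × Fin k) ℂ) :
    Matrix (Fin k' × (a × r)) (b × Fin l × Fin d) ℂ := fun x y =>
  ∑ i, E (x.2.1, x.1, y.2.2) i * (ψ (i.1, y.1, i.2.1, x.2.2) * φ (i.2.2, y.2.1))

lemma protocolOutput_isometry {k l k' l' d : ℕ} (ψ : a × b × c × r → ℂ) (φ : Fin k × Fin l → ℂ)
    (E : Matrix (a × Fin k' × Fin d) (a × c × Fin k) ℂ) (hE : Eᴴ * E = 1)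
    (dec : Channel (b × Fin l × Fin d) (b × c × Fin l')) :
    protocolOutput ψ φ (isometryChannel E hE) dec =
      ∑ k, ketbra (fun x : (a × b × c × r) × (Fin k' × Fin l') =>
        (encodedKet ψ φ E * (dec.kraus k)ᵀ) (x.2.1, (x.1.1, x.1.2.2.2))
          (x.1.2.1, x.1.2.2.1, x.2.2)) := by
  let g : (b × Fin l × Fin d) × (a × Fin k' × r) → ℂ := fun x =>
    encodedKet ψ φ E (x.2.2.1, (x.2.1, x.2.2.2)) x.1
  have h : protocolOutput ψ φ (isometryChannel E hE) dec = (dec.onFst (ketbra g)).submatrix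
      (fun x : (a × b × c × r) × (Fin k' × Fin l') =>
        ((x.1.2.1, x.1.2.2.1, x.2.2), (x.1.1, x.2.1, x.1.2.2.2)))
      (fun x : (a × b × c × r) × (Fin k' × Fin l') =>
        ((x.1.2.1, x.1.2.2.1, x.2.2), (x.1.1, x.2.1, x.1.2.2.2))) := by
    unfold protocolOutput
    simp only [ketbra_kronecker, onFst_isometryChannel, ketbra_submatrix, conjFst_ketbra]
    congr 3
    ext x
    simp [g, encodedKet, mulVec, dotProduct, Fintype.sum_prod_type, Matrix.one_apply]
  rw [h, Channel.onFst]
  ext x y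
  simp only [submatrix_apply, Matrix.sum_apply, conjFst_ketbra]
  refine Finset.sum_congr rfl fun k _ => ?_
  have h2 : ∀ z : (b × c × Fin l') × (a × Fin k' × r),
      ((dec.kraus k ⊗ₖ (1 : Matrix (a × Fin k' × r) (a × Fin k' × r) ℂ)) *ᵥ g) z =
        (encodedKet ψ φ E * (dec.kraus k)ᵀ) (z.2.2.1, (z.2.1, z.2.2.2)) z.1 := by
    intro z
    simp [g, mulVec, dotProduct, Fintype.sum_prod_type, Matrix.one_apply, Matrix.mul_apply,
      mul_comm, Prod.ext_iff, ite_and]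
  simp only [ketbra, vecMulVec_apply, Pi.star_apply, h2]

/-- The encoding isometry: first `U`, then `V`, with a bipartite catalyst. -/
def encoder {n n' m d : ℕ} (U : Matrix (a × c × Fin n) (a × c × Fin n) ℂ)
    (V : Matrix (Fin m × Fin d) ((c × Fin n) × Fin n') ℂ) :
    Matrix (a × Fin m × Fin d) (a × c × Fin (n * n')) ℂ :=
  ((1 : Matrix a a ℂ) ⊗ₖ V) *
    (U ⊗ₖ (1 : Matrix (Fin n') (Fin n') ℂ)).submatrix
      (fun y : a × (c × Fin n) × Fin n' => ((y.1, y.2.1.1, y.2.1.2), y.2.2))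
      (fun y : a × c × Fin (n * n') =>
        ((y.1, y.2.1, (finProdFinEquiv.symm y.2.2).1), (finProdFinEquiv.symm y.2.2).2))

lemma encoder_isometry {n n' m d : ℕ} {U : Matrix (a × c × Fin n) (a × c × Fin n) ℂ}
    {V : Matrix (Fin m × Fin d) ((c × Fin n) × Fin n') ℂ} (hU : Uᴴ * U = 1) (hV : Vᴴ * V = 1) :
    (encoder U V)ᴴ * encoder U V = 1 := by
  let e₁ : a × (c × Fin n) × Fin n' ≃ (a × c × Fin n) × Fin n' :=
    { toFun := fun y => ((y.1, y.2.1.1, y.2.1.2), y.2.2)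
      invFun := fun y => (y.1.1, (y.1.2.1, y.1.2.2), y.2) }
  let e₂ : a × c × Fin (n * n') ≃ (a × c × Fin n) × Fin n' :=
    { toFun := fun y =>
        ((y.1, y.2.1, (finProdFinEquiv.symm y.2.2).1), (finProdFinEquiv.symm y.2.2).2)
      invFun := fun y => (y.1.1, y.1.2.1, finProdFinEquiv (y.1.2.2, y.2))
      left_inv := fun y => by simp only [Prod.eta, Equiv.apply_symm_apply]
      right_inv := fun y => by simp }
  have h1 : ((1 : Matrix a a ℂ) ⊗ₖ V)ᴴ * ((1 : Matrix a a ℂ) ⊗ₖ V) = 1 := by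
    rw [conjTranspose_kronecker, ← mul_kronecker_mul, hV]
    simp
  have h2 : encoder U V = ((1 : Matrix a a ℂ) ⊗ₖ V) *
      (U ⊗ₖ (1 : Matrix (Fin n') (Fin n') ℂ)).submatrix e₁ e₂ := rfl
  rw [h2, conjTranspose_mul, Matrix.mul_assoc, ← Matrix.mul_assoc _ _ (submatrix _ _ _), h1,
    Matrix.one_mul, conjTranspose_submatrix, submatrix_mul_equiv, isometry_kronecker_one hU]
  simp

/-- The resource state: a purification of `σ ⊗ σ'`. -/
def resourceKet {n n' : ℕ} (S : Matrix (Fin n) (Fin n) ℂ) (S' : Matrix (Fin n') (Fin n') ℂ) :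
    Fin (n * n') × Fin (n * n') → ℂ := fun x =>
  S (finProdFinEquiv.symm x.1).1 (finProdFinEquiv.symm x.2).1 *
    S' (finProdFinEquiv.symm x.1).2 (finProdFinEquiv.symm x.2).2

lemma sum_norm_sq_eq {p q : Type*} [Fintype p] [Fintype q] {S : Matrix p q ℂ}
    (h : (S * Sᴴ).trace = 1) : ∑ i, ∑ j, ‖S i j‖ ^ 2 = 1 := by
  have : ((∑ i, ∑ j, ‖S i j‖ ^ 2 : ℝ) : ℂ) = 1 := by
    rw [← h]
    simp [trace, Matrix.mul_apply, Complex.mul_conj, Complex.normSq_eq_norm_sq]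
  exact_mod_cast this

lemma isKet_of_trace {p q : Type*} [Fintype p] [Fintype q] {S : Matrix p q ℂ}
    (h : (S * Sᴴ).trace = 1) : IsKet fun x : p × q => S x.1 x.2 := by
  rw [IsKet, Fintype.sum_prod_type]
  exact sum_norm_sq_eq h

lemma isKet_resourceKet {n n' : ℕ} {S : Matrix (Fin n) (Fin n) ℂ} {S' : Matrix (Fin n') (Fin n') ℂ}
    (hS : (S * Sᴴ).trace = 1) (hS' : (S' * S'ᴴ).trace = 1) : IsKet (resourceKet S S') := by
  rw [IsKet, ← (finProdFinEquiv.prodCongr finProdFinEquiv).sum_comp]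
  simp only [Equiv.prodCongr_apply, Prod.map, resourceKet, Equiv.symm_apply_apply, Fintype.sum_prod_type,
    norm_mul, mul_pow]
  have h1 := sum_norm_sq_eq hS
  have h2 := sum_norm_sq_eq hS'
  simp only [← Finset.sum_mul_sum, h1, h2, mul_one]

end Protocol

/-! ### From decoupling to a redistribution protocol. -/

section Achievability

variable {a b c r : Type*} [Fintype a] [DecidableEq a] [Fintype b] [DecidableEq b]
  [Fintype c] [DecidableEq c] [Fintype r] [DecidableEq r]

/-- `(A C A'') R ≃ ((A C) R) A''`. -/
def ancillaEquiv (a c r x : Type*) : (a × c × x) × r ≃ ((a × c) × r) × x where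
  toFun u := (((u.1.1, u.1.2.1), u.2), u.1.2.2)
  invFun u := ((u.1.1.1, u.1.1.2, u.2), u.1.2)

/-- `(C A'') (A R) ≃ (A C A'') R`. -/
def rotatedEquiv (a c r x : Type*) : (c × x) × (a × r) ≃ (a × c × x) × r where
  toFun u := ((u.2.1, u.1.1, u.1.2), u.2.2)
  invFun u := ((u.1.2.1, u.1.2.2), (u.1.1, u.2))

lemma IsKet.ketbra {p : Type*} [Fintype p] {v : p → ℂ} (h : IsKet v) : IsState (ketbra v) := by
  refine ⟨posSemidef_vecMulVec_self_star v, ?_⟩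
  have : ((∑ i, ‖v i‖ ^ 2 : ℝ) : ℂ) = 1 := by exact_mod_cast h
  rw [← this]
  simp [QI.ketbra, trace, vecMulVec_apply, Complex.mul_conj, Complex.normSq_eq_norm_sq]

lemma isState_margACR {ψ : a × b × c × r → ℂ} (hψ : IsKet ψ) : IsState (margACR ψ) :=
  (hψ.ketbra.submatrix (⟨fun x => (x.2.1.1, x.1, x.2.1.2, x.2.2),
    fun x => (x.2.1, ((x.1, x.2.2.1), x.2.2.2)), fun _ => rfl, fun _ => rfl⟩ :
      b × (a × c) × r ≃ a × b × c × r)).trFst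

lemma isState_margAR {ψ : a × b × c × r → ℂ} (hψ : IsKet ψ) : IsState (margAR ψ) :=
  (hψ.ketbra.submatrix (⟨fun x => (x.2.1, x.1.1, x.1.2, x.2.2),
    fun x => ((x.2.1, x.2.2.1), (x.1, x.2.2.2)), fun _ => rfl, fun _ => rfl⟩ :
      (b × c) × (a × r) ≃ a × b × c × r)).trFst

lemma isState_margCR {ψ : a × b × c × r → ℂ} (hψ : IsKet ψ) : IsState (margCR ψ) :=
  (hψ.ketbra.submatrix (⟨fun x => (x.1.1, x.1.2, x.2.1, x.2.2),
    fun x => ((x.1, x.2.1), (x.2.2.1, x.2.2.2)), fun _ => rfl, fun _ => rfl⟩ :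
      (a × b) × (c × r) ≃ a × b × c × r)).trFst

lemma isState_withAncilla {ψ : a × b × c × r → ℂ} (hψ : IsKet ψ) {n : ℕ}
    {σ : Matrix (Fin n) (Fin n) ℂ} (hσ : IsState σ) : IsState (withAncilla ψ σ) :=
  ((isState_margACR hψ).kronecker hσ).submatrix (ancillaEquiv a c r (Fin n))

lemma isState_rotated {n : ℕ} {U : Matrix (a × c × Fin n) (a × c × Fin n) ℂ} (hU : Uᴴ * U = 1)
    {ρ : Matrix ((a × c × Fin n) × r) ((a × c × Fin n) × r) ℂ} (hρ : IsState ρ) :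
    IsState (rotated U ρ) :=
  (hρ.conjFst hU).submatrix (rotatedEquiv a c r (Fin n))

lemma purifiedDist_rotated_le {n : ℕ} {U : Matrix (a × c × Fin n) (a × c × Fin n) ℂ}
    (hU : Uᴴ * U = 1) {ρ ρ' : Matrix ((a × c × Fin n) × r) ((a × c × Fin n) × r) ℂ}
    (hρ : IsState ρ) (hρ' : IsState ρ') :
    purifiedDist (rotated U ρ) (rotated U ρ') ≤ purifiedDist ρ ρ' :=
  purifiedDist_anti <| (fidelity_le_conjFst hρ.1 hρ'.1 hU).trans <|
    fidelity_le_submatrix (hρ.conjFst hU).1 (hρ'.conjFst hU).1 (rotatedEquiv a c r (Fin n))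

/-- The amplitude of `ψ_{ACR}`. -/
def ampACR (ψ : a × b × c × r → ℂ) : Matrix ((a × c) × r) b ℂ :=
  of fun x y => ψ (x.1.1, y, x.1.2, x.2)

lemma ampACR_mul (ψ : a × b × c × r → ℂ) : margACR ψ = ampACR ψ * (ampACR ψ)ᴴ := by
  ext x y
  simp [margACR, ampACR, trFst, ketbra, vecMulVec_apply, Matrix.mul_apply]

lemma withAncilla_mul (ψ : a × b × c × r → ℂ) {n : ℕ} (S : Matrix (Fin n) (Fin n) ℂ) :
    withAncilla ψ (S * Sᴴ) = (ampACR ψ ⊗ₖ S).submatrix (ancillaEquiv a c r (Fin n)) id *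
      ((ampACR ψ ⊗ₖ S).submatrix (ancillaEquiv a c r (Fin n)) id)ᴴ := by
  rw [← submatrix_mul_conjTranspose, ← kronecker_mul_conjTranspose, ← ampACR_mul]
  rfl

lemma rotated_mul {f : Type*} [Fintype f] {n : ℕ} (U : Matrix (a × c × Fin n) (a × c × Fin n) ℂ)
    (A : Matrix ((a × c × Fin n) × r) f ℂ) :
    rotated U (A * Aᴴ) =
      ((U ⊗ₖ (1 : Matrix r r ℂ)) * A).submatrix (rotatedEquiv a c r (Fin n)) id *
      (((U ⊗ₖ (1 : Matrix r r ℂ)) * A).submatrix (rotatedEquiv a c r (Fin n)) id)ᴴ := by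
  rw [← submatrix_mul_conjTranspose, ← conjFst_mul_conjTranspose]
  rfl

lemma catOut_mul {x e f : Type*} [Fintype x] [DecidableEq x] [Fintype e] [DecidableEq e] [Fintype f]
    {n m d : ℕ} (V : Matrix (Fin m × Fin d) (x × Fin n) ℂ) (A : Matrix (x × e) f ℂ)
    (S : Matrix (Fin n) (Fin n) ℂ) :
    catOut V (A * Aᴴ) (S * Sᴴ) =
      envSnd (((V ⊗ₖ (1 : Matrix e e ℂ)) *
        (A ⊗ₖ S).submatrix (prodSwapRight x (Fin n) e) id).submatrix
          (prodSwapRight (Fin m) e (Fin d)) id) *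
      (envSnd (((V ⊗ₖ (1 : Matrix e e ℂ)) *
        (A ⊗ₖ S).submatrix (prodSwapRight x (Fin n) e) id).submatrix
          (prodSwapRight (Fin m) e (Fin d)) id))ᴴ := by
  rw [envSnd_mul_conjTranspose, ← submatrix_mul_conjTranspose, ← conjFst_mul_conjTranspose,
    ← submatrix_mul_conjTranspose, ← kronecker_mul_conjTranspose]
  rfl

/-- The encoded vector is an amplitude of the state produced by catalytic decoupling. -/
lemma catOut_rotated_eq {n n' m d : ℕ} (ψ : a × b × c × r → ℂ)
    (S : Matrix (Fin n) (Fin n) ℂ) (S' : Matrix (Fin n') (Fin n') ℂ)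
    (U : Matrix (a × c × Fin n) (a × c × Fin n) ℂ)
    (V : Matrix (Fin m × Fin d) ((c × Fin n) × Fin n') ℂ) :
    catOut V (rotated U (withAncilla ψ (S * Sᴴ))) (S' * S'ᴴ) =
      encodedKet ψ (resourceKet S S') (encoder U V) *
        (encodedKet ψ (resourceKet S S') (encoder U V))ᴴ := by
  -- The environment of the decoupled state consists of Bob's registers: `B`, the purifications of
  -- the ancilla and the catalyst, and the transmitted `A₂`.
  let e : b × Fin (n * n') × Fin d ≃ Fin d × ((b × Fin n) × Fin n') :=
    { toFun := fun y =>
        (y.2.2, ((y.1, (finProdFinEquiv.symm y.2.1).1), (finProdFinEquiv.symm y.2.1).2))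
      invFun := fun y => (y.2.1.1, finProdFinEquiv (y.2.1.2, y.2.2), y.1)
      left_inv := fun y => by simp only [Prod.eta, Equiv.apply_symm_apply]
      right_inv := fun y => by simp }
  rw [withAncilla_mul, rotated_mul, catOut_mul, ← mul_conjTranspose_submatrix _ e]
  suffices h : ∀ X Y : Matrix (Fin m × (a × r)) (b × Fin (n * n') × Fin d) ℂ, X = Y →
      X * Xᴴ = Y * Yᴴ by
    refine h _ _ ?_
    ext ⟨x, a₀, r₀⟩ ⟨b₀, l₀, d₀⟩
    simp only [envSnd, encodedKet, encoder, resourceKet, submatrix_apply, id_eq, Matrix.mul_apply,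
      kronecker_apply, prodSwapRight, rotatedEquiv, ancillaEquiv, Equiv.coe_fn_mk, ampACR, of_apply,
      Fintype.sum_prod_type, e, Matrix.one_apply, mul_ite, mul_one,
      mul_zero, ite_mul, one_mul, zero_mul, Finset.sum_ite_eq, Finset.sum_ite_eq', Finset.mem_univ,
      if_true]
    simp only [← (finProdFinEquiv (m := n) (n := n')).sum_comp, Equiv.symm_apply_apply,
      Fintype.sum_prod_type]
    have hδ : ∀ f : a → c → Fin n → ℂ,
        ∑ x, ∑ y, ∑ z, (if a₀ = x then f x y z else 0) = ∑ y, ∑ z, f a₀ y z := by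
      intro f
      rw [Finset.sum_eq_single a₀ (fun x _ hx => by simp [Ne.symm hx]) (by simp)]
      simp
    simp only [hδ, Finset.sum_mul, Finset.mul_sum]
    have hcomm : ∀ f : c → Fin n → Fin n' → a → c → Fin n → ℂ,
        ∑ y, ∑ z, ∑ j, ∑ u, ∑ v, ∑ w, f y z j u v w =
          ∑ u, ∑ v, ∑ w, ∑ j, ∑ y, ∑ z, f y z j u v w := by
      intro f
      have h1 := Finset.sum_comm (s := (Finset.univ : Finset (c × Fin n × Fin n')))
        (t := (Finset.univ : Finset (a × c × Fin n)))
        (f := fun p q => f p.1 p.2.1 p.2.2 q.1 q.2.1 q.2.2)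
      simp only [Fintype.sum_prod_type] at h1
      rw [h1]
      refine Finset.sum_congr rfl fun u _ => Finset.sum_congr rfl fun v _ =>
        Finset.sum_congr rfl fun w _ => ?_
      rw [Finset.sum_comm (s := (Finset.univ : Finset (Fin n')))]
      exact Finset.sum_congr rfl fun y _ => Finset.sum_comm
    rw [hcomm]
    refine Finset.sum_congr rfl fun u _ => Finset.sum_congr rfl fun v _ =>
      Finset.sum_congr rfl fun w _ => Finset.sum_congr rfl fun j _ =>
      Finset.sum_congr rfl fun y _ => Finset.sum_congr rfl fun z _ => by ring
  rintro X _ rfl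
  rfl

/-- The amplitude of the target state `ω ⊗ ψ_{AR}`. -/
def targetAmp {m : ℕ} (ψ : a × b × c × r → ℂ) (W : Matrix (Fin m) (Fin m) ℂ) :
    Matrix (Fin m × (a × r)) (b × c × Fin m) ℂ :=
  of fun x y => ψ (x.2.1, y.1, y.2.1, x.2.2) * W x.1 y.2.2

lemma targetAmp_mul {m : ℕ} (ψ : a × b × c × r → ℂ) (W : Matrix (Fin m) (Fin m) ℂ) :
    targetAmp ψ W * (targetAmp ψ W)ᴴ = (W * Wᴴ) ⊗ₖ margAR ψ := by
  ext x y
  rw [kronecker_apply]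
  simp only [targetAmp, Matrix.mul_apply, of_apply, conjTranspose_apply, margAR,
    trFst, ketbra, submatrix_apply, vecMulVec_apply, Pi.star_apply, Fintype.sum_prod_type,
    star_mul', Finset.mul_sum, Finset.sum_mul]
  refine Finset.sum_congr rfl fun _ _ => Finset.sum_congr rfl fun _ _ =>
    Finset.sum_congr rfl fun _ _ => by ring

/-- The decoupled state and `ω ⊗ ψ_{AR}` have amplitudes whose columns are Bob's systems before and
after decoding, so the optimal contraction between them acts on Bob's side only. -/
lemma qsrAchievable_of_catDecouples {ψ : a × b × c × r → ℂ} (hψ : IsKet ψ) {ε : ℝ} {n d : ℕ}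
    {σ : Matrix (Fin n) (Fin n) ℂ} {ρ : Matrix ((a × c × Fin n) × r) ((a × c × Fin n) × r) ℂ}
    {U : Matrix (a × c × Fin n) (a × c × Fin n) ℂ} (hf : Feasible ε ψ σ ρ U)
    (hd : CatDecouples ε (rotated U ρ) d) : QSRAchievable ψ (3 * ε) (Real.logb 2 d) := by
  obtain ⟨hσ, ⟨hρ, hρψ⟩, hU, hAR⟩ := hf
  obtain ⟨n', m, σ', V, ω, τ, hσ', hV, -, hω, hτ, hP⟩ := hd
  have hU' : Uᴴ * U = 1 := mem_unitaryGroup_iff'.1 hU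
  have hψσ := isState_withAncilla hψ hσ
  have hS := sqrt_mul_conjTranspose hσ.1
  have hS' := sqrt_mul_conjTranspose hσ'.1
  have hW := sqrt_mul_conjTranspose hω.1
  have hkey : purifiedDist (catOut V (rotated U (withAncilla ψ σ)) σ') (ω ⊗ₖ margAR ψ) ≤ 3 * ε := by
    refine purifiedDist_kronecker_le (ξ := catOut V (rotated U ρ) σ')
      ((isState_rotated hU' hψσ).catOut hV hσ') ((isState_rotated hU' hρ).catOut hV hσ') hω hτ
      (isState_margAR hψ) ?_ hP ?_
    · exact ((purifiedDist_catOut_le hV (isState_rotated hU' hρ) (isState_rotated hU' hψσ)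
        hσ').trans (purifiedDist_rotated_le hU' hρ hψσ)).trans hρψ
    · rw [trFst_catOut hV (isState_rotated hU' hρ) hσ']
      exact hAR.2
  have hX := catOut_rotated_eq ψ (CFC.sqrt σ) (CFC.sqrt σ') U V
  rw [hS, hS'] at hX
  have hT := targetAmp_mul ψ (CFC.sqrt ω)
  rw [hW] at hT
  set X := encodedKet ψ (resourceKet (CFC.sqrt σ) (CFC.sqrt σ')) (encoder U V) with hXdef
  obtain ⟨K, hK, hF⟩ := exists_contr_fidelity X (targetAmp ψ (CFC.sqrt ω))
  rw [← hX, hT] at hF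
  -- Completing `K` to a channel needs an output basis vector; one exists because the target has
  -- trace one.
  have hne : Nonempty (b × c × Fin m) := by
    by_contra hcon
    rw [not_nonempty_iff] at hcon
    have h0 : targetAmp ψ (CFC.sqrt ω) * (targetAmp ψ (CFC.sqrt ω))ᴴ = 0 := by
      ext x y; simp [Matrix.mul_apply]
    have h1 := (hω.kronecker (isState_margAR hψ)).2
    rw [← hT, h0, trace_zero] at h1
    exact zero_ne_one h1
  -- Bob acts on column indices, so his Kraus operator enters transposed: its transpose must be
  -- `Kᴴ`.
  have hKt : IsContr (Kᴴ)ᵀ := by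
    have h1 := PosSemidef.transpose hK
    have h2 : (Kᴴᵀ)ᴴ = Kᵀ := by ext; simp
    rw [transpose_sub, transpose_one, transpose_mul] at h1
    rw [IsContr, h2]
    exact h1
  obtain ⟨dec, k₀, hdec⟩ := exists_channel_kraus hKt
  refine ⟨n * n', n * n', m, m, d, resourceKet (CFC.sqrt σ) (CFC.sqrt σ'),
    fun x => CFC.sqrt ω x.1 x.2, isometryChannel (encoder U V) (encoder_isometry hU' hV), dec,
    isKet_resourceKet (by rw [hS, hσ.2]) (by rw [hS', hσ'.2]), isKet_of_trace (by rw [hW, hω.2]),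
    rfl, le_trans (purifiedDist_anti ?_) hkey⟩
  rw [protocolOutput_isometry, ketbra_kronecker, ← hF, ← hXdef]
  refine le_trans (le_of_eq ?_) (re_dotProduct_le_fidelity _ _ k₀)
  rw [hdec, transpose_transpose, ← conjTranspose_conjTranspose K, ← hsInner_mul_right_left,
    conjTranspose_conjTranspose]
  unfold hsInner
  congr 1
  have hflat : ((X * Kᴴ)ᴴ * targetAmp ψ (CFC.sqrt ω)).trace =
      ∑ z : (b × c × Fin m) × (Fin m × (a × r)),
        star ((X * Kᴴ) z.2 z.1) * targetAmp ψ (CFC.sqrt ω) z.2 z.1 := by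
    rw [Fintype.sum_prod_type]
    rfl
  rw [hflat]
  let e : (a × b × c × r) × (Fin m × Fin m) ≃ (b × c × Fin m) × (Fin m × (a × r)) :=
    { toFun := fun z => ((z.1.2.1, z.1.2.2.1, z.2.2), (z.2.1, (z.1.1, z.1.2.2.2)))
      invFun := fun z => ((z.2.2.1, z.1.1, z.1.2.1, z.2.2.2), (z.2.1, z.1.2.2)) }
  rw [← e.sum_comp]
  rfl

end Achievability

/-! ### Invariance of catalytic decoupling, and attainment of the minimal dimension. -/

section Reindexing

variable {a a' a'' e e' : Type*} [Fintype a] [DecidableEq a] [Fintype a'] [DecidableEq a']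
  [Fintype a''] [DecidableEq a''] [Fintype e] [DecidableEq e] [Fintype e'] [DecidableEq e']

lemma conjFst_conjFst (V : Matrix a'' a' ℂ) (W : Matrix a' a ℂ) (ρ : Matrix (a × e) (a × e) ℂ) :
    conjFst V (conjFst W ρ) = conjFst (V * W) ρ := by
  have h : (V * W) ⊗ₖ (1 : Matrix e e ℂ) =
      (V ⊗ₖ (1 : Matrix e e ℂ)) * (W ⊗ₖ (1 : Matrix e e ℂ)) := by
    rw [← mul_kronecker_mul, Matrix.mul_one]
  simp only [conjFst, h, conjTranspose_mul, Matrix.mul_assoc]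

lemma conjFst_one (ρ : Matrix (a × e) (a × e) ℂ) : conjFst (1 : Matrix a a ℂ) ρ = ρ := by
  simp [conjFst]

lemma conjFst_submatrix_left (V : Matrix a'' a ℂ) (g : a' ≃ a) (ρ : Matrix (a × e) (a × e) ℂ) :
    conjFst (V.submatrix id g) (ρ.submatrix (g.prodCongr (Equiv.refl e))
      (g.prodCongr (Equiv.refl e))) = conjFst V ρ := by
  have h : (V.submatrix id g) ⊗ₖ (1 : Matrix e e ℂ) =
      (V ⊗ₖ (1 : Matrix e e ℂ)).submatrix id (g.prodCongr (Equiv.refl e)) := rfl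
  rw [conjFst, h, conjTranspose_submatrix, submatrix_mul_equiv, submatrix_mul_equiv,
    submatrix_id_id]
  rfl

lemma conjFst_submatrix_right (V : Matrix a' a ℂ) (g : e' ≃ e) (ρ : Matrix (a × e) (a × e) ℂ) :
    conjFst V (ρ.submatrix ((Equiv.refl a).prodCongr g) ((Equiv.refl a).prodCongr g)) =
      (conjFst V ρ).submatrix ((Equiv.refl a').prodCongr g) ((Equiv.refl a').prodCongr g) := by
  have h : V ⊗ₖ (1 : Matrix e' e' ℂ) = (V ⊗ₖ (1 : Matrix e e ℂ)).submatrix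
      ((Equiv.refl a').prodCongr g) ((Equiv.refl a).prodCongr g) := by
    ext ⟨i, j⟩ ⟨k, l⟩
    simp [Matrix.one_apply]
  rw [conjFst, h, conjTranspose_submatrix, submatrix_mul_equiv, submatrix_mul_equiv]
  rfl

lemma catOut_conjFst {n m d : ℕ} (V : Matrix (Fin m × Fin d) (a' × Fin n) ℂ) (W : Matrix a' a ℂ)
    (ρ : Matrix (a × e) (a × e) ℂ) (σ : Matrix (Fin n) (Fin n) ℂ) :
    catOut V (conjFst W ρ) σ = catOut (V * (W ⊗ₖ (1 : Matrix (Fin n) (Fin n) ℂ))) ρ σ := by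
  have h : ((conjFst W ρ) ⊗ₖ σ).submatrix (prodSwapRight a' (Fin n) e)
      (prodSwapRight a' (Fin n) e) = conjFst (W ⊗ₖ (1 : Matrix (Fin n) (Fin n) ℂ))
        ((ρ ⊗ₖ σ).submatrix (prodSwapRight a (Fin n) e) (prodSwapRight a (Fin n) e)) := by
    have h1 : (W ⊗ₖ (1 : Matrix (Fin n) (Fin n) ℂ)) ⊗ₖ (1 : Matrix e e ℂ) =
        ((W ⊗ₖ (1 : Matrix e e ℂ)) ⊗ₖ (1 : Matrix (Fin n) (Fin n) ℂ)).submatrix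
          (prodSwapRight a' (Fin n) e) (prodSwapRight a (Fin n) e) := by
      ext ⟨⟨i, j⟩, k⟩ ⟨⟨i', j'⟩, k'⟩
      simp only [kronecker_apply, submatrix_apply, prodSwapRight, Equiv.coe_fn_mk]
      ring
    rw [conjFst, conjFst, h1, conjTranspose_submatrix, submatrix_mul_equiv, submatrix_mul_equiv,
      conjTranspose_kronecker (W ⊗ₖ (1 : Matrix e e ℂ)), ← mul_kronecker_mul, ← mul_kronecker_mul]
    simp
  rw [catOut, h, conjFst_conjFst, catOut]

/-- A unitary on the decoupled system can be performed as the first part of `V`. -/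
lemma CatDecouples.of_conjFst {ε : ℝ} {W : Matrix a' a ℂ} (hW : Wᴴ * W = 1) (hW' : W * Wᴴ = 1)
    {ρ : Matrix (a × e) (a × e) ℂ} {d : ℕ} (h : CatDecouples ε (conjFst W ρ) d) :
    CatDecouples ε ρ d := by
  obtain ⟨n, m, σ, V, ω, τ, hσ, hV, hV', hω, hτ, hP⟩ := h
  refine ⟨n, m, σ, V * (W ⊗ₖ (1 : Matrix (Fin n) (Fin n) ℂ)), ω, τ, hσ, ?_, ?_, hω, hτ, ?_⟩
  · rw [conjTranspose_mul, Matrix.mul_assoc, ← Matrix.mul_assoc Vᴴ, hV, Matrix.one_mul,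
      isometry_kronecker_one hW]
  · rw [conjTranspose_mul, Matrix.mul_assoc, ← Matrix.mul_assoc (_ ⊗ₖ _), conjTranspose_kronecker,
      ← mul_kronecker_mul, hW']
    simpa using hV'
  · change purifiedDist (catOut _ ρ σ) _ ≤ ε
    rw [← catOut_conjFst]
    exact hP

lemma CatDecouples.submatrix_left {ε : ℝ} (g : a' ≃ a) {ρ : Matrix (a × e) (a × e) ℂ} {d : ℕ}
    (h : CatDecouples ε ρ d) : CatDecouples ε (ρ.submatrix (g.prodCongr (Equiv.refl e))
      (g.prodCongr (Equiv.refl e))) d := by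
  refine CatDecouples.of_conjFst (W := (1 : Matrix a a ℂ).submatrix id g) ?_ ?_ ?_
  · rw [conjTranspose_submatrix, conjTranspose_one, ← submatrix_mul _ _ _ _ _ Function.bijective_id]
    simp
  · rw [conjTranspose_submatrix, submatrix_mul_equiv]
    simp
  · rwa [conjFst_submatrix_left, conjFst_one]

lemma CatDecouples.submatrix_right {ε : ℝ} (g : e' ≃ e) {ρ : Matrix (a × e) (a × e) ℂ}
    (hρ : IsState ρ) {d : ℕ}
    (h : CatDecouples ε ρ d) : CatDecouples ε (ρ.submatrix ((Equiv.refl a).prodCongr g)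
      ((Equiv.refl a).prodCongr g)) d := by
  obtain ⟨n, m, σ, V, ω, τ, hσ, hV, hV', hω, hτ, hP⟩ := h
  refine ⟨n, m, σ, V, ω, τ.submatrix g g, hσ, hV, hV', hω, hτ.submatrix g, ?_⟩
  let g' := (Equiv.refl (Fin m)).prodCongr g
  have h1 : catOut V (ρ.submatrix ((Equiv.refl a).prodCongr g) ((Equiv.refl a).prodCongr g)) σ =
      (catOut V ρ σ).submatrix g' g' := by
    have h2 := conjFst_submatrix_right V g ((ρ ⊗ₖ σ).submatrix (prodSwapRight a (Fin n) e)
      (prodSwapRight a (Fin n) e))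
    rw [catOut]
    refine (congrArg (fun M => trSnd (M.submatrix (prodSwapRight (Fin m) e' (Fin d))
      (prodSwapRight (Fin m) e' (Fin d)))) h2).trans ?_
    rfl
  change purifiedDist (catOut V _ σ) _ ≤ ε
  rw [h1]
  exact (purifiedDist_anti (fidelity_le_submatrix (hρ.catOut hV hσ).1
    (hω.1.kronecker hτ.1) g')).trans hP

/-- A state tensored on can be absorbed into the catalyst. -/
lemma CatDecouples.of_kronecker {ε : ℝ} {ρ : Matrix (a × e) (a × e) ℂ} {n : ℕ}
    {σ : Matrix (Fin n) (Fin n) ℂ} (hσ : IsState σ) {d : ℕ}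
    (h : CatDecouples ε ((ρ ⊗ₖ σ).submatrix (prodSwapRight a (Fin n) e)
      (prodSwapRight a (Fin n) e)) d) : CatDecouples ε ρ d := by
  obtain ⟨n', m, σ', V, ω, τ, hσ', hV, hV', hω, hτ, hP⟩ := h
  let g : a × Fin (n * n') ≃ (a × Fin n) × Fin n' :=
    { toFun := fun y => ((y.1, (finProdFinEquiv.symm y.2).1), (finProdFinEquiv.symm y.2).2)
      invFun := fun y => (y.1.1, finProdFinEquiv (y.1.2, y.2))
      left_inv := fun y => by simp only [Prod.eta, Equiv.apply_symm_apply]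
      right_inv := fun y => by simp }
  refine ⟨n * n', m, (σ ⊗ₖ σ').submatrix finProdFinEquiv.symm finProdFinEquiv.symm,
    V.submatrix id g, ω, τ, (hσ.kronecker hσ').submatrix _, ?_, ?_, hω, hτ, ?_⟩
  · rw [conjTranspose_submatrix, ← submatrix_mul _ _ _ _ _ Function.bijective_id, hV]
    simp
  · rw [conjTranspose_submatrix, submatrix_mul_equiv, hV']
    simp
  · convert hP using 6
    rw [← conjFst_submatrix_left V g]
    congr 1
    ext x y
    simp [g, prodSwapRight, mul_assoc]

lemma isState_one : IsState (1 : Matrix (Fin 1) (Fin 1) ℂ) := ⟨PosSemidef.one, by simp⟩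

/-- Discarding all of `A` leaves a one-dimensional `A₁`, which is in product with anything. -/
lemma exists_catDecouples {ε : ℝ} (hε : 0 ≤ ε) {ρ : Matrix (a × e) (a × e) ℂ} (hρ : IsState ρ) :
    ∃ d, CatDecouples ε ρ d := by
  let e₁ : Fin 1 × Fin (Fintype.card a) ≃ a :=
    (Equiv.uniqueProd _ _).trans (Fintype.equivFin a).symm
  let e₂ : a × Fin 1 ≃ a := Equiv.prodUnique _ _
  let V := (1 : Matrix a a ℂ).submatrix e₁ e₂
  have hV : Vᴴ * V = 1 := by
    simp only [V]
    rw [conjTranspose_submatrix, submatrix_mul_equiv]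
    simp
  have hV' : V * Vᴴ = 1 := by
    simp only [V]
    rw [conjTranspose_submatrix, submatrix_mul_equiv]
    simp
  have hs := hρ.catOut hV isState_one
  refine ⟨Fintype.card a, 1, 1, 1, V, 1, trFst (catOut V ρ 1), isState_one, hV, hV', isState_one,
    hs.trFst, ?_⟩
  have h : (1 : Matrix (Fin 1) (Fin 1) ℂ) ⊗ₖ trFst (catOut V ρ 1) = catOut V ρ 1 := by
    ext ⟨i, j⟩ ⟨k, l⟩
    rw [Subsingleton.elim i 0, Subsingleton.elim k 0]
    simp [trFst]
  rw [h]
  exact (purifiedDist_self hs).le.trans hε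

lemma catDecouples_sInf {ε : ℝ} (hε : 0 ≤ ε) {ρ : Matrix (a × e) (a × e) ℂ} (hρ : IsState ρ) :
    CatDecouples ε ρ (sInf {d : ℕ | CatDecouples ε ρ d}) :=
  Nat.sInf_mem (exists_catDecouples hε hρ)

/-- Monotonicity includes `0`, because `Real.logb 2 0 = 0` by convention. -/
lemma logb_two_natCast_mono {k l : ℕ} (h : k ≤ l) : Real.logb 2 k ≤ Real.logb 2 l := by
  rcases Nat.eq_zero_or_pos k with rfl | hk
  · rcases Nat.eq_zero_or_pos l with rfl | hl
    · exact le_rfl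
    · simpa using Real.logb_nonneg one_lt_two (by exact_mod_cast hl)
  · exact Real.logb_le_logb_of_le one_lt_two (by exact_mod_cast hk) (by exact_mod_cast h)

lemma catRemainder_le {ε ε' : ℝ} (hε : 0 ≤ ε) {ρ : Matrix (a × e) (a × e) ℂ} (hρ : IsState ρ)
    {ρ' : Matrix (a' × e') (a' × e') ℂ} (h : ∀ d, CatDecouples ε ρ d → CatDecouples ε' ρ' d) :
    catRemainder ε' ρ' ≤ catRemainder ε ρ :=
  logb_two_natCast_mono (Nat.sInf_le (h _ (catDecouples_sInf hε hρ)))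

/-- Well-ordering of the natural numbers: the infimum defining a cost is attained, hence realized by
an actual protocol. -/
lemma exists_isLeast_of_logb {S : Set ℝ} (hS : S.Nonempty)
    (h : ∀ x ∈ S, ∃ k : ℕ, x = Real.logb 2 k) :
    ∃ x, IsLeast S x := by
  have hne : {k : ℕ | Real.logb 2 k ∈ S}.Nonempty := by
    obtain ⟨x, hx⟩ := hS
    obtain ⟨k, rfl⟩ := h x hx
    exact ⟨k, hx⟩
  refine ⟨_, Nat.sInf_mem hne, fun x hx => ?_⟩
  obtain ⟨k, rfl⟩ := h x hx
  exact logb_two_natCast_mono (Nat.sInf_le hx)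

end Reindexing

/-! ### The optimized cost and its comparison with decoupling. -/

section Cost

variable {a b c r : Type*} [Fintype a] [DecidableEq a] [Fintype b] [DecidableEq b]
  [Fintype c] [DecidableEq c] [Fintype r] [DecidableEq r]

lemma feasible_trivial {ψ : a × b × c × r → ℂ} (hψ : IsKet ψ) {ε : ℝ} (hε : 0 ≤ ε) :
    Feasible ε ψ (1 : Matrix (Fin 1) (Fin 1) ℂ) (withAncilla ψ 1) 1 := by
  have hs := isState_withAncilla hψ isState_one
  have h : trFst (rotated 1 (withAncilla ψ (1 : Matrix (Fin 1) (Fin 1) ℂ))) = margAR ψ := by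
    rw [rotated, conjFst_one]
    ext x y
    simp only [trFst, withAncilla, margACR, margAR, submatrix_apply, kronecker_apply,
      Fintype.sum_prod_type, Matrix.one_apply, Fin.sum_univ_one, if_true, mul_one]
    exact Finset.sum_comm
  refine ⟨isState_one, ⟨hs, (purifiedDist_self hs).le.trans hε⟩, one_mem _, ?_⟩
  rw [h]
  exact ⟨isState_margAR hψ, (purifiedDist_self (isState_margAR hψ)).le.trans hε⟩

lemma exists_qCost_eq {ψ : a × b × c × r → ℂ} (hψ : IsKet ψ) {ε : ℝ} (hε : 0 ≤ ε) :
    ∃ (n : ℕ) (σ : Matrix (Fin n) (Fin n) ℂ)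
      (ρ : Matrix ((a × c × Fin n) × r) ((a × c × Fin n) × r) ℂ)
      (U : Matrix (a × c × Fin n) (a × c × Fin n) ℂ),
      Feasible ε ψ σ ρ U ∧ qCost ε ψ = catRemainder ε (rotated U ρ) ∧
      ∀ (n' : ℕ) (σ' : Matrix (Fin n') (Fin n') ℂ)
        (ρ' : Matrix ((a × c × Fin n') × r) ((a × c × Fin n') × r) ℂ)
        (U' : Matrix (a × c × Fin n') (a × c × Fin n') ℂ), Feasible ε ψ σ' ρ' U' →
        qCost ε ψ ≤ catRemainder ε (rotated U' ρ') := by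
  obtain ⟨x, hx⟩ := exists_isLeast_of_logb (S := {x : ℝ | ∃ (n : ℕ)
    (σ : Matrix (Fin n) (Fin n) ℂ) (ρ : Matrix ((a × c × Fin n) × r) ((a × c × Fin n) × r) ℂ)
    (U : Matrix (a × c × Fin n) (a × c × Fin n) ℂ),
    Feasible ε ψ σ ρ U ∧ x = catRemainder ε (rotated U ρ)})
    ⟨_, 1, 1, _, 1, feasible_trivial hψ hε, rfl⟩
    (fun x ⟨_, _, _, _, _, h⟩ => ⟨_, h⟩)
  have hq : qCost ε ψ = x := hx.csInf_eq
  obtain ⟨n, σ, ρ, U, hf, hxe⟩ := hx.1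
  exact ⟨n, σ, ρ, U, hf, hq.trans hxe, fun n' σ' ρ' U' hf' =>
    hq.le.trans (hx.2 ⟨n', σ', ρ', U', hf', rfl⟩)⟩

lemma exists_qCostExact_eq {ψ : a × b × c × r → ℂ} (hψ : IsKet ψ) {ε : ℝ} (hε : 0 ≤ ε) :
    ∃ (n : ℕ) (σ : Matrix (Fin n) (Fin n) ℂ) (U : Matrix (a × c × Fin n) (a × c × Fin n) ℂ),
      Feasible ε ψ σ (withAncilla ψ σ) U ∧
      qCostExact ε ψ = catRemainder ε (rotated U (withAncilla ψ σ)) ∧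
      ∀ (n' : ℕ) (σ' : Matrix (Fin n') (Fin n') ℂ)
        (U' : Matrix (a × c × Fin n') (a × c × Fin n') ℂ),
        Feasible ε ψ σ' (withAncilla ψ σ') U' →
        qCostExact ε ψ ≤ catRemainder ε (rotated U' (withAncilla ψ σ')) := by
  obtain ⟨x, hx⟩ := exists_isLeast_of_logb (S := {x : ℝ | ∃ (n : ℕ)
    (σ : Matrix (Fin n) (Fin n) ℂ) (U : Matrix (a × c × Fin n) (a × c × Fin n) ℂ),
    Feasible ε ψ σ (withAncilla ψ σ) U ∧ x = catRemainder ε (rotated U (withAncilla ψ σ))})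
    ⟨_, 1, 1, 1, feasible_trivial hψ hε, rfl⟩
    (fun x ⟨_, _, _, _, h⟩ => ⟨_, h⟩)
  have hq : qCostExact ε ψ = x := hx.csInf_eq
  obtain ⟨n, σ, U, hf, hxe⟩ := hx.1
  exact ⟨n, σ, U, hf, hq.trans hxe, fun n' σ' U' hf' =>
    hq.le.trans (hx.2 ⟨n', σ', U', hf', rfl⟩)⟩

lemma Feasible.isState_rotated {ψ : a × b × c × r → ℂ} {ε : ℝ} {n : ℕ}
    {σ : Matrix (Fin n) (Fin n) ℂ} {ρ : Matrix ((a × c × Fin n) × r) ((a × c × Fin n) × r) ℂ}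
    {U : Matrix (a × c × Fin n) (a × c × Fin n) ℂ} (hf : Feasible ε ψ σ ρ U) :
    IsState (rotated U ρ) :=
  QI.isState_rotated (mem_unitaryGroup_iff'.1 hf.2.2.1) hf.2.1.1

lemma Feasible.qsrAchievable {ψ : a × b × c × r → ℂ} (hψ : IsKet ψ) {ε : ℝ} (hε : 0 ≤ ε) {n : ℕ}
    {σ : Matrix (Fin n) (Fin n) ℂ} {ρ : Matrix ((a × c × Fin n) × r) ((a × c × Fin n) × r) ℂ}
    {U : Matrix (a × c × Fin n) (a × c × Fin n) ℂ} (hf : Feasible ε ψ σ ρ U) :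
    QSRAchievable ψ (3 * ε) (catRemainder ε (rotated U ρ)) :=
  qsrAchievable_of_catDecouples hψ hf (catDecouples_sInf hε hf.isState_rotated)

/-- The same catalyst, `V` and product state serve: replacing `ρ` by `ψ ⊗ σ` moves the decoupled
state by at most `ε`. -/
lemma Feasible.catDecouples_two_mul {ψ : a × b × c × r → ℂ} (hψ : IsKet ψ) {ε : ℝ} {n : ℕ}
    {σ : Matrix (Fin n) (Fin n) ℂ} {ρ : Matrix ((a × c × Fin n) × r) ((a × c × Fin n) × r) ℂ}
    {U : Matrix (a × c × Fin n) (a × c × Fin n) ℂ} (hf : Feasible ε ψ σ ρ U) {d : ℕ}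
    (h : CatDecouples ε (rotated U ρ) d) :
    CatDecouples (2 * ε) (rotated U (withAncilla ψ σ)) d := by
  obtain ⟨n', m, σ', V, ω, τ, hσ', hV, hV', hω, hτ, hP⟩ := h
  have hU := mem_unitaryGroup_iff'.1 hf.2.2.1
  have hs := isState_withAncilla hψ hf.1
  have hs' := QI.isState_rotated hU hs
  refine ⟨n', m, σ', V, ω, τ, hσ', hV, hV', hω, hτ, purifiedDist_le_two_mul
    (ρ := catOut V (rotated U ρ) σ') (hs'.catOut hV hσ') (hf.isState_rotated.catOut hV hσ')
    (hω.kronecker hτ) ?_ hP⟩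
  exact ((purifiedDist_catOut_le hV hf.isState_rotated hs' hσ').trans
    (purifiedDist_rotated_le hU hf.2.1.1 hs)).trans hf.2.1.2

/-! ### State merging: trivial `A`. -/

section Merging

variable [Unique a]

/-- For trivial `A`, the unitary `U` as an operator on `C A''`. -/
def restrictUnitary {n : ℕ} (U : Matrix (a × c × Fin n) (a × c × Fin n) ℂ) :
    Matrix (c × Fin n) (c × Fin n) ℂ :=
  U.submatrix (Equiv.uniqueProd (c × Fin n) a).symm (Equiv.uniqueProd (c × Fin n) a).symm

lemma rotated_withAncilla_eq (ψ : a × b × c × r → ℂ) {n : ℕ} (σ : Matrix (Fin n) (Fin n) ℂ)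
    (U : Matrix (a × c × Fin n) (a × c × Fin n) ℂ) :
    rotated U (withAncilla ψ σ) =
      (conjFst (restrictUnitary U) ((margCR ψ ⊗ₖ σ).submatrix (prodSwapRight c (Fin n) r)
        (prodSwapRight c (Fin n) r))).submatrix
          ((Equiv.refl (c × Fin n)).prodCongr (Equiv.uniqueProd r a))
          ((Equiv.refl (c × Fin n)).prodCongr (Equiv.uniqueProd r a)) := by
  let g := (Equiv.uniqueProd (c × Fin n) a).symm
  have h1 : (margCR ψ ⊗ₖ σ).submatrix (prodSwapRight c (Fin n) r) (prodSwapRight c (Fin n) r) =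
      (withAncilla ψ σ).submatrix (g.prodCongr (Equiv.refl r)) (g.prodCongr (Equiv.refl r)) := by
    ext x y
    simp [withAncilla, margCR, margACR, trFst, prodSwapRight, g, Fintype.sum_prod_type]
  have h2 : restrictUnitary U = (U.submatrix g id).submatrix id g := rfl
  rw [h1, h2, conjFst_submatrix_left]
  have h3 : conjFst (U.submatrix g id) (withAncilla ψ σ) = (conjFst U (withAncilla ψ σ)).submatrix
      (g.prodCongr (Equiv.refl r)) (g.prodCongr (Equiv.refl r)) := rfl
  rw [h3]
  ext ⟨x, i, x'⟩ ⟨y, j, y'⟩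
  rw [Subsingleton.elim i default, Subsingleton.elim j default]
  rfl

/-- With `A` trivial, `U` acts within the system to be decoupled and joins `V`, while `σ` joins the
catalyst. -/
lemma catDecouples_margCR_of_rotated {ψ : a × b × c × r → ℂ} (hψ : IsKet ψ) {ε : ℝ} {n : ℕ}
    {σ : Matrix (Fin n) (Fin n) ℂ} (hσ : IsState σ)
    {U : Matrix (a × c × Fin n) (a × c × Fin n) ℂ} (hU : U ∈ unitaryGroup (a × c × Fin n) ℂ)
    {d : ℕ} (h : CatDecouples ε (rotated U (withAncilla ψ σ)) d) :
    CatDecouples ε (margCR ψ) d := by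
  have hU₁ := mem_unitaryGroup_iff'.1 hU
  have hU₂ := mem_unitaryGroup_iff.1 hU
  have h' := h.submatrix_right (Equiv.uniqueProd r a).symm
    (isState_rotated hU₁ (isState_withAncilla hψ hσ))
  rw [rotated_withAncilla_eq, submatrix_submatrix] at h'
  refine CatDecouples.of_kronecker hσ (CatDecouples.of_conjFst (W := restrictUnitary U) ?_ ?_ ?_)
  · rw [restrictUnitary, conjTranspose_submatrix, submatrix_mul_equiv]
    erw [hU₁]; simp
  · rw [restrictUnitary, conjTranspose_submatrix, submatrix_mul_equiv]
    erw [hU₂]; simp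
  · exact h'

lemma catDecouples_rotated_of_margCR {ψ : a × b × c × r → ℂ} (hψ : IsKet ψ) {ε : ℝ} {d : ℕ}
    (h : CatDecouples ε (margCR ψ) d) :
    CatDecouples ε (rotated 1 (withAncilla ψ (1 : Matrix (Fin 1) (Fin 1) ℂ))) d := by
  have h1 : restrictUnitary (1 : Matrix (a × c × Fin 1) (a × c × Fin 1) ℂ) = 1 := by
    simp [restrictUnitary]
  rw [rotated_withAncilla_eq, h1, conjFst_one]
  have h2 : (margCR ψ ⊗ₖ (1 : Matrix (Fin 1) (Fin 1) ℂ)).submatrix (prodSwapRight c (Fin 1) r)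
      (prodSwapRight c (Fin 1) r) = (margCR ψ).submatrix
        ((Equiv.prodUnique c (Fin 1)).prodCongr (Equiv.refl r))
        ((Equiv.prodUnique c (Fin 1)).prodCongr (Equiv.refl r)) := by
    ext x y
    simp [prodSwapRight, Subsingleton.elim x.1.2 y.1.2]
    rfl
  rw [h2]
  exact (h.submatrix_left (Equiv.prodUnique c (Fin 1))).submatrix_right _
    ((isState_margCR hψ).submatrix _)

end Merging

end Cost

end QI

end

theorem mainTheorem8 {a b c r : Type*} [Fintype a] [DecidableEq a] [Fintype b] [DecidableEq b]
    [Fintype c] [DecidableEq c] [Fintype r] [DecidableEq r]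
    (ψ : a × b × c × r → ℂ) (hψ : QI.IsKet ψ) (ε : ℝ) (hε : 0 ≤ ε) :
    QI.QSRAchievable ψ (3 * ε) (QI.qCost ε ψ) ∧
    (Fintype.card a = 1 →
      QI.QSRAchievable ψ (3 * ε) (QI.catRemainder ε (QI.margCR ψ)) ∧
      QI.qCostExact ε ψ = QI.catRemainder ε (QI.margCR ψ) ∧
      QI.catRemainder (2 * ε) (QI.margCR ψ) ≤ QI.qCost ε ψ ∧
      QI.qCost ε ψ ≤ QI.catRemainder ε (QI.margCR ψ)) := by
  obtain ⟨n, σ, ρ, U, hf, hq, hmin⟩ := QI.exists_qCost_eq hψ hε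
  refine ⟨hq ▸ hf.qsrAchievable hψ hε, fun hcard => ?_⟩
  obtain ⟨_⟩ := Fintype.card_eq_one_iff_nonempty_unique.1 hcard
  obtain ⟨n', σ', U', hf', hq', hmin'⟩ := QI.exists_qCostExact_eq hψ hε
  have hmarg : QI.IsState (QI.margCR ψ) := QI.isState_margCR hψ
  have htriv := QI.feasible_trivial hψ hε
  have hle : QI.catRemainder ε (QI.rotated 1 (QI.withAncilla ψ 1)) ≤
      QI.catRemainder ε (QI.margCR ψ) :=
    QI.catRemainder_le hε hmarg fun d => QI.catDecouples_rotated_of_margCR hψ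
  have hexact : QI.qCostExact ε ψ = QI.catRemainder ε (QI.margCR ψ) := by
    -- One bound uses the trivial ancilla with `U = 1`; the other absorbs an optimal ancilla and
    -- unitary into the catalytic procedure.
    refine le_antisymm ((hmin' _ _ _ htriv).trans hle) ?_
    rw [hq']
    exact QI.catRemainder_le hε hf'.isState_rotated fun d =>
      QI.catDecouples_margCR_of_rotated hψ hf'.1 hf'.2.2.1
  refine ⟨?_, hexact, ?_, (hmin _ _ _ _ htriv).trans hle⟩
  · rw [← hexact, hq']
    exact hf'.qsrAchievable hψ hε
  -- At an optimal tuple, the smoothing is first undone at the price of `2ε`, and then `U` and `σ`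
  -- are absorbed.
  · rw [hq]
    exact QI.catRemainder_le hε hf.isState_rotated fun d hd =>
      QI.catDecouples_margCR_of_rotated hψ hf.1 hf.2.2.1 (hf.catDecouples_two_mul hψ hd)
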